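/- Let $\mathcal M\subset\mathbb R^3$ be a smooth compact embedded surface (without boundary) homeomorphic to the sphere $\mathbb S^2$, with area measure $\mathcal H^2$ and tangential gradient $\nabla$. Let $H\in C^1(\mathcal M)$ satisfy $\int_{\mathcal M}H\,d\mathcal H^2=0$, and let $\beta>0$. Let $H^1(\mathcal M)$ be the Sobolev space of $\mathcal M$ (the completion of $C^\infty(\mathcal M)$ for the norm $(\int V^2+\int|\nabla V|^2)^{1/2}$). For $V\in H^1(\mathcal M)$ set $$E_\beta(V)=\int_{\mathcal M}|\nabla V|^2\,d\mathcal H^2+\beta\int_{\mathcal M}|-\Delta V+H|\in[0,\infty],\qquad \mathcal F(V)=\int_{\mathcal M}\bigl(|\nabla V|^2+2HV\bigr)\,d\mathcal H^2 ,$$ where $-\Delta V+H$ is the distribution $\varphi\mapsto\int_{\mathcal M}(\nabla V\cdot\nabla\varphi+H\varphi)\,d\mathcal H^2$, $\varphi\in C^\infty(\mathcal M)$, and $\int_{\mathcal M}|-\Delta V+H|$ denotes its total variation $|\mu|(\mathcal M)$ if it is given by a finite signed Radon measure $\mu$, and $+\infty$ otherwise. Then a function $V_0\in H^1(\mathcal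 M)$ minimizes $E_\beta$ over $H^1(\mathcal M)$ if and only if $\operatorname{ess\,sup}V_0-\operatorname{ess\,inf}V_0\le\beta$ and $V_0$ minimizes $\mathcal F$ among all $V\in H^1(\mathcal M)$ such that $\operatorname{ess\,sup}V-\operatorname{ess\,inf}V\le\beta$. -/

import Mathlib

open MeasureTheory Filter Topology
open scoped ContDiff ENNReal

noncomputable section

namespace SurfaceObstacle

/-- Euclidean three-space. Functions and vector fields on a surface `M` are represented by maps
defined on `R3`; every notion below depends only on their values on `M`. -/
abbrev R3 : Type := EuclideanSpace ℝ (Fin 3)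

/-- `M` is a smooth embedded surface without boundary in `ℝ³`: near each of its points, a smooth
diffeomorphism between open subsets of `ℝ³` flattens `M` to the plane `{y | y 2 = 0}`. -/
def IsSmoothSurface (M : Set R3) : Prop :=
  ∀ p ∈ M, ∃ Φ : OpenPartialHomeomorph R3 R3, p ∈ Φ.source ∧
    ContDiffOn ℝ ∞ Φ Φ.source ∧ ContDiffOn ℝ ∞ Φ.symm Φ.target ∧
    ∀ x ∈ Φ.source, (x ∈ M ↔ Φ x 2 = 0)

/-- The area measure `ℋ²` of `M`, extended by zero to `ℝ³`; the two-dimensional Hausdorff measure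
is normalized so as to agree with the Lebesgue measure on planes. -/
def area (M : Set R3) : Measure R3 :=
  (Measure.euclideanHausdorffMeasure 2 : Measure R3).restrict M

/-- The tangent space `T_x M`, spanned by the velocities at `x` of the curves in `M`. -/
def tangentPlane (M : Set R3) (x : R3) : Submodule ℝ R3 :=
  Submodule.span ℝ {v | ∃ γ : ℝ → R3, γ 0 = x ∧ (∀ᶠ t in 𝓝 0, γ t ∈ M) ∧ HasDerivAt γ v 0}

/-- The gradient along `M` of (the restriction to `M` of) a smooth function: the orthogonal
projection of its gradient in `ℝ³` to the tangent space. -/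
def tangentialGrad (M : Set R3) (φ : R3 → ℝ) (x : R3) : R3 :=
  (tangentPlane M x).starProjection (gradient φ x)

/-- `V ∈ H¹(M)` with gradient `G`: the pair `(V, G)` is the limit in `L²(M) × L²(M; ℝ³)` of pairs
`(φₙ, ∇φₙ)` with `φₙ` smooth on `M`. -/
def HasWeakGradient (M : Set R3) (V : R3 → ℝ) (G : R3 → R3) : Prop :=
  MemLp V 2 (area M) ∧ MemLp G 2 (area M) ∧
    ∃ φ : ℕ → R3 → ℝ, (∀ n, ContDiff ℝ ∞ (φ n)) ∧
      Tendsto (fun n => eLpNorm (fun x => φ n x - V x) 2 (area M)) atTop (𝓝 0) ∧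
      Tendsto (fun n => eLpNorm (fun x => tangentialGrad M (φ n) x - G x) 2 (area M))
        atTop (𝓝 0)

/-- The Sobolev space `H¹(M)`, the completion of the smooth functions on `M`
for the norm `(∫ V² + ∫ |∇V|²)^{1/2}`. -/
def MemH1 (M : Set R3) (V : R3 → ℝ) : Prop :=
  ∃ G, HasWeakGradient M V G

open Classical in
/-- The gradient of `V ∈ H¹(M)` (unique up to null sets on a smooth surface). -/
def weakGrad (M : Set R3) (V : R3 → ℝ) : R3 → R3 :=
  if h : MemH1 M V then h.choose else 0

/-- The integral of a function against a finite signed measure. -/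
def signedIntegral {X : Type*} [MeasurableSpace X] (μ : SignedMeasure X) (f : X → ℝ) : ℝ :=
  ∫ x, f x ∂μ.toJordanDecomposition.posPart - ∫ x, f x ∂μ.toJordanDecomposition.negPart

/-- The distribution `-ΔV + H` on `M` is the finite signed (Radon) measure `μ`, that is
`∫ ∇V · ∇φ + ∫ H φ = ∫ φ dμ` for all smooth `φ`. -/
def IsVorticity (M : Set R3) (H V : R3 → ℝ) (μ : SignedMeasure M) : Prop :=
  ∀ φ : R3 → ℝ, ContDiff ℝ ∞ φ →
    ∫ x, inner ℝ (weakGrad M V x) (tangentialGrad M φ x) ∂area M + ∫ x, H x * φ x ∂area M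
      = signedIntegral μ (fun x : M => φ x)

/-- `∫ |-ΔV + H|`: the total variation of the measure `-ΔV + H` if that distribution is a finite
signed measure (which is then unique), and `∞` otherwise (an infimum over the empty set). -/
def vorticityMass (M : Set R3) (H V : R3 → ℝ) : ℝ≥0∞ :=
  ⨅ (μ : SignedMeasure M) (_ : IsVorticity M H V μ), μ.totalVariation Set.univ

/-- The mean-field energy `E_β(V) = ∫ |∇V|² + β ∫ |-ΔV + H|`, with values in `[0, ∞]`. -/
def meanFieldEnergy (M : Set R3) (H : R3 → ℝ) (β : ℝ) (V : R3 → ℝ) : ℝ≥0∞ :=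
  ∫⁻ x, ‖weakGrad M V x‖ₑ ^ 2 ∂area M + ENNReal.ofReal β * vorticityMass M H V

/-- The functional `ℱ(V) = ∫ (|∇V|² + 2 H V)`. -/
def obstacleEnergy (M : Set R3) (H V : R3 → ℝ) : ℝ :=
  ∫ x, (‖weakGrad M V x‖ ^ 2 + 2 * H x * V x) ∂area M

/-- `ess sup V - ess inf V` on `M`, in the extended reals: it is `∞` if `V` is essentially
unbounded. -/
def essOsc (M : Set R3) (V : R3 → ℝ) : EReal :=
  essSup (fun x => (V x : EReal)) (area M) - essInf (fun x => (V x : EReal)) (area M)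

/-- The admissible class of the two-sided obstacle problem. -/
def admissible (M : Set R3) (β : ℝ) : Set (R3 → ℝ) :=
  {V | MemH1 M V ∧ essOsc M V ≤ (β : EReal)}

end SurfaceObstacle

end

/-! ### Nested convex sets in a Hilbert space, and smooth truncation of real values. -/

namespace SurfaceObstacle

/-! The two problems are convex duals, and the minimum of $E_\beta$ is minus the minimum of
$\mathcal F$ on the admissible class. Write $\langle\mu_V,Z\rangle=\int(\nabla V\cdot\nabla Z+HZ)$
for the pairing of $-\Delta V+H$ with $Z$. Completing the square gives $|\nabla
V|^2-2\langle\mu_V,Z\rangle=|\nabla V-\nabla Z|^2-\mathcal F(Z)$ under integration.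

Lower bound (`le_meanFieldEnergy`): if $\mu_V$ is a measure, testing with $1$ and using $\int H=0$
shows that its positive and negative parts have the same mass $p$. If $Z$ takes values in an
interval of length $\beta$, then $\langle\mu_V,Z\rangle\ge-\beta p$, while $|\mu_V|$ has mass $2p$.
Hence $E_\beta(V)\ge\int|\nabla V-\nabla Z|^2-\mathcal F(Z)$ for every $V$ and every admissible $Z$.

Equality at obstacle minimizers (`meanFieldEnergy_le_of_isMin`): if $W$ solves the obstacle problem,
the first variation gives $\langle\mu_W,W\rangle\le\langle\mu_W,Z\rangle$ for admissible $Z$. Taking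
for $Z$ a negative multiple of a smooth $\varphi$, scaled to oscillation $\beta$, bounds
$\langle\mu_W,\varphi\rangle$ by $k\operatorname{osc}\varphi$ with $k=-\langle\mu_W,W\rangle/\beta$.
By Hahn–Banach and Riesz (`exists_signedMeasure_of_le_osc`), $\mu_W$ is a measure of mass at most
$2k$, so $E_\beta(W)\le-\mathcal F(W)$.

Together these show that obstacle minimizers minimize $E_\beta$. Conversely, a minimizer of
$E_\beta$ has the same gradient as an obstacle minimizer, which exists by `exists_isMin_pairEnergy`.
As $M$ is connected, the two differ by a constant, and constants change neither $\mathcal F$ nor the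
oscillation.

The analytic groundwork realizes $H^1(M)$ as a closed subspace of $L^2\times L^2$: closability of
the tangential gradient makes `weakGrad` well defined, vanishing gradient forces constancy, and
bounded elements are limits of smooth functions with nearly the same bounds. The first two are
proved in charts. -/

/-- A decreasing sequence of nonempty bounded closed convex sets in a Hilbert space has a common
point. -/
theorem exists_forall_mem_of_antitone_convex {F : Type*} [NormedAddCommGroup F]
    [InnerProductSpace ℝ F] [CompleteSpace F] {S : ℕ → Set F} (hS : Antitone S)
    (hne : ∀ n, (S n).Nonempty) (hcl : ∀ n, IsClosed (S n)) (hcv : ∀ n, Convex ℝ (S n))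
    {R : ℝ} (hR : ∀ x ∈ S 0, ‖x‖ ≤ R) : ∃ x, ∀ n, x ∈ S n := by
  have hmin : ∀ n, ∃ v ∈ S n, ∀ w ∈ S n, ‖v‖ ≤ ‖w‖ := by
    intro n
    obtain ⟨v, hv, h⟩ := exists_norm_eq_iInf_of_complete_convex (hne n) (hcl n).isComplete (hcv n) 0
    refine ⟨v, hv, fun w hw => ?_⟩
    simp only [zero_sub, norm_neg] at h
    rw [h]
    exact ciInf_le (f := fun w : S n => ‖(w : F)‖)
      ⟨0, Set.forall_mem_range.2 fun _ => norm_nonneg _⟩ ⟨w, hw⟩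
  choose x hx hxm using hmin
  have hmono : Monotone fun n => ‖x n‖ ^ 2 := fun n k hnk => by
    have := hxm n (x k) (hS hnk (hx k))
    dsimp only
    gcongr
  have hbd : BddAbove (Set.range fun n => ‖x n‖ ^ 2) := by
    refine ⟨R ^ 2, ?_⟩
    rintro _ ⟨n, rfl⟩
    have := hR (x n) (hS (Nat.zero_le n) (hx n))
    dsimp only
    gcongr
  have hlim := tendsto_atTop_ciSup hmono hbd
  -- The midpoint of `x n` and `x k` lies in `S n`, so its norm is at least `‖x n‖`; the
  -- parallelogram law then bounds the distance by the increment of the squared norms, which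
  -- converge.
  have hkey : ∀ n k, n ≤ k → ‖x n - x k‖ ^ 2 ≤ 2 * (‖x k‖ ^ 2 - ‖x n‖ ^ 2) := by
    intro n k hnk
    have hmid : (1 / 2 : ℝ) • x n + (1 / 2 : ℝ) • x k ∈ S n :=
      hcv n (hx n) (hS hnk (hx k)) (by norm_num) (by norm_num) (by norm_num)
    have h1 := hxm n _ hmid
    rw [← smul_add, norm_smul] at h1
    norm_num at h1
    have h2 : (2 * ‖x n‖) ^ 2 ≤ ‖x n + x k‖ ^ 2 := by
      have := norm_nonneg (x n)
      gcongr; linarith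
    have h3 := parallelogram_law_with_norm ℝ (x n) (x k)
    nlinarith
  have hC : CauchySeq x := by
    rw [Metric.cauchySeq_iff']
    intro ε hε
    have hCy := hlim.cauchySeq
    rw [Metric.cauchySeq_iff'] at hCy
    obtain ⟨N, hN⟩ := hCy (ε ^ 2 / 2) (by positivity)
    refine ⟨N, fun n hn => ?_⟩
    have h1 := hN n hn
    rw [Real.dist_eq, abs_lt] at h1
    have h2 := hkey N n hn
    rw [dist_comm, dist_eq_norm]
    refine lt_of_pow_lt_pow_left₀ 2 hε.le ?_
    linarith
  obtain ⟨y, hy⟩ := cauchySeq_tendsto_of_complete hC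
  refine ⟨y, fun n => (hcl n).mem_of_tendsto hy ?_⟩
  filter_upwards [eventually_ge_atTop n] with k hk using hS hk (hx k)

/-- A smooth nondecreasing contraction of the line that is the identity on `[a, b]` and takes
values in `[a - ε, b + ε]`. -/
theorem exists_smooth_truncation {a b ε : ℝ} (hab : a < b) (hε : 0 < ε) :
    ∃ T : ℝ → ℝ, ContDiff ℝ ∞ T ∧ (∀ x, a - ε ≤ T x ∧ T x ≤ b + ε) ∧
      (∀ x, 0 ≤ deriv T x ∧ deriv T x ≤ 1) ∧ (∀ x ∈ Set.Icc a b, T x = x) ∧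
      ∀ x ∈ Set.Icc a b, deriv T x = 1 := by
  -- `T` is the primitive of a bump equal to `1` on `[a, b]` and vanishing outside `[a - ε, b + ε]`;
  -- the bounds `0 ≤ ψ ≤ 1` make it a monotone contraction.
  let ψ : ContDiffBump ((a + b) / 2) := ⟨(b - a) / 2, (b - a) / 2 + ε, by linarith, by linarith⟩
  have hψc : Continuous ψ := ψ.continuous
  have hii : ∀ x y, IntervalIntegrable ψ volume x y := fun x y => hψc.intervalIntegrable x y
  let T : ℝ → ℝ := fun x => a + ∫ t in a..x, ψ t
  have hd : ∀ x, HasDerivAt T (ψ x) x := fun x =>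
    (intervalIntegral.integral_hasDerivAt_right (hii a x)
      hψc.aestronglyMeasurable.stronglyMeasurableAtFilter hψc.continuousAt).const_add a
  have hder : deriv T = ψ := funext fun x => (hd x).deriv
  have h1 : ∀ x ∈ Set.Icc a b, ψ x = 1 := by
    intro x hx
    apply ψ.one_of_mem_closedBall
    rw [Metric.mem_closedBall, Real.dist_eq, abs_le]
    change -((b - a) / 2) ≤ _ ∧ _ ≤ (b - a) / 2
    constructor <;> linarith [hx.1, hx.2]
  have h0 : ∀ x, x ≤ a - ε ∨ b + ε ≤ x → ψ x = 0 := by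
    intro x hx
    apply ψ.zero_of_le_dist
    rw [Real.dist_eq]
    change (b - a) / 2 + ε ≤ _
    rcases hx with hx | hx
    · exact le_trans (by linarith) (neg_le_abs _)
    · exact le_trans (by linarith) (le_abs_self _)
  have hid : ∀ x ∈ Set.Icc a b, T x = x := by
    intro x hx
    have : ∫ t in a..x, ψ t = ∫ t in a..x, (1 : ℝ) := by
      apply intervalIntegral.integral_congr
      intro t ht
      rw [Set.uIcc_of_le hx.1] at ht
      exact h1 t ⟨ht.1, ht.2.trans hx.2⟩
    change a + ∫ t in a..x, ψ t = x
    rw [this]; simp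
  have hmono : Monotone T := monotone_of_deriv_nonneg (fun x => (hd x).differentiableAt)
    fun x => by rw [hder]; exact ψ.nonneg
  have hlip : ∀ x y, x ≤ y → T y - T x ≤ y - x := by
    intro x y hxy
    have : T y - T x = ∫ t in x..y, ψ t := by
      have := intervalIntegral.integral_add_adjacent_intervals (hii a x) (hii x y)
      simp only [T]; linarith
    rw [this]
    calc ∫ t in x..y, ψ t ≤ ∫ t in x..y, (1 : ℝ) :=
          intervalIntegral.integral_mono_on hxy (hii x y) (by simp) fun t _ => ψ.le_one
      _ = y - x := by simp
  -- `T` is constant beyond `b + ε`, and the contraction property from `T b = b` bounds that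
  -- constant.
  have hhi : ∀ x, b + ε ≤ x → T x ≤ b + ε := by
    intro x hx
    have h2 : ∫ t in (b + ε)..x, ψ t = 0 := by
      rw [intervalIntegral.integral_congr (g := fun _ => (0 : ℝ))]
      · simp
      · intro t ht
        rw [Set.uIcc_of_le hx] at ht
        exact h0 t (Or.inr ht.1)
    have h3 := intervalIntegral.integral_add_adjacent_intervals (hii a (b + ε)) (hii (b + ε) x)
    have h4 := hlip b (b + ε) (by linarith)
    rw [hid b ⟨hab.le, le_rfl⟩] at h4
    simp only [T] at h4 ⊢
    linarith
  have hlo : ∀ x, x ≤ a - ε → a - ε ≤ T x := by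
    intro x hx
    have h2 : ∫ t in x..(a - ε), ψ t = 0 := by
      rw [intervalIntegral.integral_congr (g := fun _ => (0 : ℝ))]
      · simp
      · intro t ht
        rw [Set.uIcc_of_le hx] at ht
        exact h0 t (Or.inl ht.2)
    have h3 := intervalIntegral.integral_add_adjacent_intervals (hii a x) (hii x (a - ε))
    have h4 := hlip (a - ε) a (by linarith)
    rw [hid a ⟨le_rfl, hab.le⟩] at h4
    simp only [T] at h4 ⊢
    linarith
  refine ⟨T, ?_, fun x => ⟨?_, ?_⟩, fun x => ?_, hid, fun x hx => by rw [hder, h1 x hx]⟩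
  · rw [contDiff_infty_iff_deriv]
    exact ⟨fun x => (hd x).differentiableAt, by rw [hder]; exact ψ.contDiff⟩
  · exact (hlo _ (min_le_right x _)).trans (hmono (min_le_left x _))
  · exact (hmono (le_max_left x (b + ε))).trans (hhi _ (le_max_right x _))
  · rw [hder]; exact ⟨ψ.nonneg, ψ.le_one⟩

end SurfaceObstacle

/-! ### Representation of functionals bounded by the oscillation. -/

namespace SurfaceObstacle

/-- A positive linear functional on the continuous functions on a compact space is the integral
against a finite measure. -/
theorem exists_measure_of_nonneg {X : Type*} [TopologicalSpace X] [CompactSpace X] [T2Space X]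
    [MeasurableSpace X] [BorelSpace X] (P : C(X, ℝ) →ₗ[ℝ] ℝ) (hP : ∀ f, 0 ≤ f → 0 ≤ P f) :
    ∃ μ : Measure X, IsFiniteMeasure μ ∧ ∀ f : C(X, ℝ), ∫ x, f x ∂μ = P f := by
  let e : C(X, ℝ) → CompactlySupportedContinuousMap X ℝ := fun f =>
    ⟨f, HasCompactSupport.of_compactSpace f⟩
  let Λ : CompactlySupportedContinuousMap X ℝ →ₚ[ℝ] ℝ := PositiveLinearMap.mk₀
    { toFun := fun f => P (f : C(X, ℝ))
      map_add' := fun f g => by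
        rw [← map_add]; rfl
      map_smul' := fun c f => by
        rw [RingHom.id_apply, ← map_smul]; rfl }
    (fun f hf => hP _ (fun x => hf x))
  refine ⟨RealRMK.rieszMeasure Λ, inferInstance, fun f => ?_⟩
  exact RealRMK.integral_rieszMeasure Λ (e f)

/-- `P` and `N` need not be mutually singular, hence need not be the Jordan parts. Moving the
negative terms across gives an equality of positive measures, which can be integrated. -/
theorem signedIntegral_eq_of_toSignedMeasure_sub {X : Type*} [MeasurableSpace X]
    {P N : Measure X} [IsFiniteMeasure P] [IsFiniteMeasure N] {f : X → ℝ}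
    (hf : ∀ ν : Measure X, IsFiniteMeasure ν → Integrable f ν) :
    signedIntegral (P.toSignedMeasure - N.toSignedMeasure) f = ∫ x, f x ∂P - ∫ x, f x ∂N := by
  set μ := P.toSignedMeasure - N.toSignedMeasure with hμ
  have h1 : μ.toJordanDecomposition.posPart + N = μ.toJordanDecomposition.negPart + P := by
    ext i hi
    have h2 := μ.apply_eq_posPart_real_sub_negPart_real hi
    rw [hμ, Measure.toSignedMeasure_sub_apply hi, ← hμ] at h2
    rw [← ENNReal.toReal_eq_toReal_iff' (measure_ne_top _ _) (measure_ne_top _ _),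
      ← measureReal_def, ← measureReal_def, measureReal_add_apply, measureReal_add_apply]
    linarith
  have h2 : ∫ x, f x ∂(μ.toJordanDecomposition.posPart + N)
    = ∫ x, f x ∂(μ.toJordanDecomposition.negPart + P) := by rw [h1]
  rw [integral_add_measure (hf _ inferInstance) (hf _ inferInstance),
    integral_add_measure (hf _ inferInstance) (hf _ inferInstance)] at h2
  rw [signedIntegral]
  linarith

/-- On a Hahn set `i` the positive part has mass `P i - N i`, and the negative part has mass `N iᶜ -
P iᶜ`. -/
theorem totalVariation_univ_le_of_toSignedMeasure_sub {X : Type*} [MeasurableSpace X]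
    {P N : Measure X} [IsFiniteMeasure P] [IsFiniteMeasure N] :
    (P.toSignedMeasure - N.toSignedMeasure).totalVariation Set.univ
      ≤ P Set.univ + N Set.univ := by
  set μ := P.toSignedMeasure - N.toSignedMeasure with hμ
  obtain ⟨i, hi, hp, hn, hip, hin⟩ := μ.toJordanDecomposition_spec
  rw [SignedMeasure.totalVariation, Measure.add_apply, hip, hin,
    SignedMeasure.toMeasureOfZeroLE_apply _ _ hi MeasurableSet.univ,
    SignedMeasure.toMeasureOfLEZero_apply _ _ hi.compl MeasurableSet.univ,
    ← ENNReal.ofReal_eq_coe_nnreal, ← ENNReal.ofReal_eq_coe_nnreal, Set.inter_univ, Set.inter_univ,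
    hμ, Measure.toSignedMeasure_sub_apply hi, Measure.toSignedMeasure_sub_apply hi.compl]
  have key : ∀ (P N : Measure X) [IsFiniteMeasure P] (j : Set X),
      ENNReal.ofReal (P.real j - N.real j) ≤ P Set.univ := fun P N _ j => by
    refine (ENNReal.ofReal_le_ofReal (sub_le_self _ measureReal_nonneg)).trans ?_
    rw [ofReal_measureReal]
    exact measure_mono (Set.subset_univ _)
  rw [neg_sub]
  exact add_le_add (key P N i) (key N P iᶜ)

/-- A linear functional `L` that is bounded by `k` times the oscillation is represented by a signed
measure of total variation at most `2 k`. -/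
theorem exists_signedMeasure_of_le_osc {X : Type*} [TopologicalSpace X] [CompactSpace X]
    [Nonempty X] [T2Space X] [MeasurableSpace X] [BorelSpace X] {S : Type*} [AddCommGroup S]
    [Module ℝ S] (r : S →ₗ[ℝ] C(X, ℝ)) (L : S →ₗ[ℝ] ℝ) {k : ℝ} (hk : 0 ≤ k)
    (hL : ∀ s a b, (∀ x, a ≤ r s x ∧ r s x ≤ b) → L s ≤ k * (b - a)) :
    ∃ μ : SignedMeasure X, μ.totalVariation Set.univ ≤ ENNReal.ofReal (2 * k) ∧
      ∀ s, signedIntegral μ (r s) = L s := by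
  have hbd : ∀ f : C(X, ℝ), BddAbove (Set.range f) := fun f =>
    (isCompact_range f.continuous).bddAbove
  let m : C(X, ℝ) → ℝ := fun f => ⨆ x, f x
  have hm_le : ∀ (f : C(X, ℝ)) c, (∀ x, f x ≤ c) → m f ≤ c := fun f c h => ciSup_le h
  have hle_m : ∀ (f : C(X, ℝ)) x, f x ≤ m f := fun f x => le_ciSup (hbd f) x
  have hm_add : ∀ f g, m (f + g) ≤ m f + m g := fun f g =>
    hm_le _ _ fun x => add_le_add (hle_m f x) (hle_m g x)
  have hm_smul : ∀ (c : ℝ) (f : C(X, ℝ)), 0 < c → m (c • f) = c * m f := fun c f hc => by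
    simp only [m, ContinuousMap.smul_apply, smul_eq_mul]
    rw [Real.mul_iSup_of_nonneg hc.le]
  -- On the graph of pairs `(f, -f)`, the sublinear functional `k * (m p.1 + m p.2)` is `k` times
  -- the oscillation of `f`. Extending to all pairs splits `L` into two functionals, each bounded by
  -- `k` times the maximum.
  let r2 : S →ₗ[ℝ] C(X, ℝ) × C(X, ℝ) := r.prod (-r)
  -- `r` need not be injective; a linear section transports `L` to the range, and the choice is
  -- harmless because `L` vanishes on the kernel of `r`.
  obtain ⟨g, hg⟩ := LinearMap.exists_rightInverse_of_surjective r2.rangeRestrict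
    (LinearMap.range_rangeRestrict r2)
  have hLker : ∀ s, r s = 0 → L s = 0 := by
    intro s hs
    apply le_antisymm
    · simpa using hL s 0 0 (by simp [hs])
    · simpa using hL (-s) 0 0 (by simp [hs])
  have hgr : ∀ s, L (g (r2.rangeRestrict s)) = L s := by
    intro s
    have h1 : r2.rangeRestrict (g (r2.rangeRestrict s)) = r2.rangeRestrict s :=
      LinearMap.congr_fun hg _
    have h2 : r2 (g (r2.rangeRestrict s)) = r2 s := congrArg Subtype.val h1
    have h3 : r (g (r2.rangeRestrict s)) = r s := congrArg Prod.fst h2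
    rw [← sub_eq_zero, ← map_sub]
    exact hLker _ (by rw [map_sub, h3, sub_self])
  obtain ⟨Λ, hΛ1, hΛ2⟩ := exists_extension_of_le_sublinear
    (⟨LinearMap.range r2, L ∘ₗ g⟩ : (C(X, ℝ) × C(X, ℝ)) →ₗ.[ℝ] ℝ)
    (fun p => k * (m p.1 + m p.2))
    (fun c hc p => by simp only [Prod.smul_fst, Prod.smul_snd, hm_smul _ _ hc]; ring)
    (fun p q => by
      have := hm_add p.1 q.1
      have := hm_add p.2 q.2
      simp only [Prod.fst_add, Prod.snd_add]
      nlinarith)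
    (by
      rintro ⟨_, s, rfl⟩
      change L (g (r2.rangeRestrict s)) ≤ k * (m (r s) + m (-(r s)))
      rw [hgr]
      have := hL s (-(m (-(r s)))) (m (r s)) fun x =>
        ⟨by have := hle_m (-(r s)) x; simp only [ContinuousMap.neg_apply] at this; linarith,
          hle_m _ x⟩
      linarith)
  have hm0 : m 0 = 0 := by simp [m]
  let A : C(X, ℝ) →ₗ[ℝ] ℝ := Λ ∘ₗ LinearMap.inl ℝ _ _
  let B : C(X, ℝ) →ₗ[ℝ] ℝ := Λ ∘ₗ LinearMap.inr ℝ _ _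
  have hA : ∀ f, A f ≤ k * m f := fun f => by
    have := hΛ2 (f, 0); simpa [hm0, A, B] using this
  have hB : ∀ f, B f ≤ k * m f := fun f => by
    have := hΛ2 (0, f); simpa [hm0, A, B] using this
  -- A bound by `k` times the maximum, applied to `-f` with `f ≥ 0`, gives positivity; applied to
  -- `1` below, it bounds the mass by `k`.
  have hnn : ∀ A : C(X, ℝ) →ₗ[ℝ] ℝ, (∀ f, A f ≤ k * m f) → ∀ f, 0 ≤ f → 0 ≤ A f := by
    intro A hA f hf
    have h1 := hA (-f)
    have h2 : m (-f) ≤ 0 := hm_le _ _ fun x => by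
      simpa using hf x
    rw [map_neg] at h1
    nlinarith
  obtain ⟨P, _, hP⟩ := exists_measure_of_nonneg A (hnn A hA)
  obtain ⟨N, _, hN⟩ := exists_measure_of_nonneg B (hnn B hB)
  have hmass : ∀ (A : C(X, ℝ) →ₗ[ℝ] ℝ) (P : Measure X), IsFiniteMeasure P →
      (∀ f, A f ≤ k * m f) → (∀ f : C(X, ℝ), ∫ x, f x ∂P = A f) →
      P Set.univ ≤ ENNReal.ofReal k := by
    intro A P _ hA hP
    have h1 := hP 1
    have h2 := hA 1
    have h3 : m 1 ≤ 1 := hm_le _ _ fun x => le_rfl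
    simp only [ContinuousMap.one_apply, integral_const, smul_eq_mul, mul_one] at h1
    rw [← ENNReal.ofReal_toReal (measure_ne_top P Set.univ)]
    apply ENNReal.ofReal_le_ofReal
    rw [← measureReal_def, h1]
    nlinarith
  refine ⟨P.toSignedMeasure - N.toSignedMeasure, ?_, fun s => ?_⟩
  · refine totalVariation_univ_le_of_toSignedMeasure_sub.trans ?_
    rw [two_mul, ENNReal.ofReal_add hk hk]
    exact add_le_add (hmass A P inferInstance hA hP) (hmass B N inferInstance hB hN)
  · rw [signedIntegral_eq_of_toSignedMeasure_sub, hP, hN]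
    · have h1 := hΛ1 (r2.rangeRestrict s)
      change Λ (r s, -(r s)) = L (g (r2.rangeRestrict s)) at h1
      rw [hgr] at h1
      rw [← h1]
      simp only [A, B, LinearMap.comp_apply, ← map_sub]
      congr 1
      simp
    · intro ν _
      exact (BoundedContinuousFunction.mkOfCompact (r s)).integrable ν
end SurfaceObstacle

/-! ### Weak derivatives in Euclidean space: closability and constancy. -/

namespace SurfaceObstacle

theorem setLIntegral_comp_add_right_le {E : Type*} [AddGroup E] [MeasurableSpace E]
    [MeasurableAdd E] {μ : Measure E} [μ.IsAddRightInvariant] {A B : Set E} (hA : MeasurableSet A) (hB : MeasurableSet B)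
    {h : E} (hAB : ∀ x ∈ A, x + h ∈ B) (g : E → ℝ≥0∞) :
    ∫⁻ x in A, g (x + h) ∂μ ≤ ∫⁻ x in B, g x ∂μ := by
  rw [← lintegral_indicator hA, ← lintegral_indicator hB,
    ← lintegral_add_right_eq_self (B.indicator g) h]
  refine lintegral_mono fun x => ?_
  by_cases hx : x ∈ A
  · simp [hx, hAB x hx]
  · simp [hx]

section Euclidean

variable {E : Type*} [NormedAddCommGroup E] [NormedSpace ℝ E] [FiniteDimensional ℝ E]
  [MeasurableSpace E] [BorelSpace E] {μ : Measure E} [μ.IsAddHaarMeasure]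

/-- Directional differentiation is closable in `L¹`. -/
theorem ae_eq_zero_of_tendsto_fderiv {B : Set E} (hB : IsOpen B) {f : ℕ → E → ℝ}
    (hf : ∀ n, ContDiff ℝ 1 (f n)) {v : E} {g : E → ℝ} (hg : IntegrableOn g B μ)
    (h0 : Tendsto (fun n => ∫⁻ x in B, ‖f n x‖ₑ ∂μ) atTop (𝓝 0))
    (h1 : Tendsto (fun n => ∫⁻ x in B, ‖fderiv ℝ (f n) x v - g x‖ₑ ∂μ) atTop (𝓝 0)) :
    ∀ᵐ x ∂μ, x ∈ B → g x = 0 := by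
  refine hB.ae_eq_zero_of_integral_contDiff_smul_eq_zero hg.locallyIntegrableOn ?_
  intro χ hχ hχc hχB
  have hχ1 : ContDiff ℝ 1 χ := hχ.of_le (by simp)
  have hdχ : Continuous fun x => fderiv ℝ χ x v :=
    (hχ1.continuous_fderiv one_ne_zero).clm_apply continuous_const
  have hdf : ∀ n, Continuous fun x => fderiv ℝ (f n) x v := fun n =>
    ((hf n).continuous_fderiv one_ne_zero).clm_apply continuous_const
  have hdχc : HasCompactSupport fun x => fderiv ℝ χ x v := hχc.fderiv_apply (𝕜 := ℝ) v
  have hbound : ∀ w : E → ℝ, Continuous w → HasCompactSupport w → ∃ C : ℝ, ∀ x, ‖w x‖ ≤ C :=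
    fun w hw hwc => hwc.exists_bound_of_continuous hw
  -- multiplication by a bounded function preserves convergence in mean
  have hconv : ∀ w : E → ℝ, Continuous w → HasCompactSupport w → ∀ (F : ℕ → E → ℝ) (G : E → ℝ),
      (∀ n, Continuous (F n)) → IntegrableOn G B μ →
      Tendsto (fun n => ∫⁻ x in B, ‖F n x - G x‖ₑ ∂μ) atTop (𝓝 0) →
      Tendsto (fun n => ∫ x in B, F n x * w x ∂μ) atTop (𝓝 (∫ x in B, G x * w x ∂μ)) := by
    intro w hw hwc F G hF hG hFG
    obtain ⟨C, hC⟩ := hbound w hw hwc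
    refine tendsto_integral_of_L1 _ ?_ (Eventually.of_forall fun n => ?_) ?_
    · exact (hG.mul_bdd hw.aestronglyMeasurable (Eventually.of_forall hC)).aestronglyMeasurable
    · exact (((hF n).mul hw).integrable_of_hasCompactSupport hwc.mul_left).integrableOn
    · have h2 : Tendsto (fun n => ENNReal.ofReal C * ∫⁻ x in B, ‖F n x - G x‖ₑ ∂μ) atTop
          (𝓝 (ENNReal.ofReal C * 0)) :=
        ENNReal.Tendsto.const_mul hFG (Or.inr ENNReal.ofReal_ne_top)
      rw [mul_zero] at h2
      refine tendsto_of_tendsto_of_tendsto_of_le_of_le tendsto_const_nhds h2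
        (fun _ => bot_le) fun n => ?_
      dsimp only
      rw [← lintegral_const_mul' _ _ ENNReal.ofReal_ne_top]
      refine lintegral_mono fun x => ?_
      rw [← sub_mul, enorm_mul, mul_comm]
      gcongr
      rw [← ofReal_norm]
      exact ENNReal.ofReal_le_ofReal (hC x)
  have e1 := hconv χ hχ.continuous hχc (fun n x => fderiv ℝ (f n) x v) g hdf hg h1
  have e2 := hconv _ hdχ hdχc f 0 (fun n => (hf n).continuous) integrableOn_zero (by simpa using h0)
  have hsub : ∀ w : E → ℝ, tsupport w ⊆ B → ∀ F : E → ℝ,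
      ∫ x in B, F x * w x ∂μ = ∫ x, F x * w x ∂μ := fun w hw F =>
    setIntegral_eq_integral_of_forall_compl_eq_zero fun x hx => by
      rw [image_eq_zero_of_notMem_tsupport (fun h => hx (hw h)), mul_zero]
  have hdsub : tsupport (fun x => fderiv ℝ χ x v) ⊆ B :=
    (tsupport_fderiv_apply_subset ℝ v).trans hχB
  -- The support of `χ` in `B` removes boundary terms. In the limit the left side tends to `0` and
  -- the right side to minus the integral of `g * χ`.
  have e3 : ∀ n, ∫ x in B, f n x * fderiv ℝ χ x v ∂μ = - ∫ x in B, fderiv ℝ (f n) x v * χ x ∂μ := by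
    intro n
    rw [hsub _ hdsub, hsub _ hχB]
    refine integral_mul_fderiv_eq_neg_fderiv_mul_of_integrable ?_ ?_ ?_ ?_ ?_
    · exact ((hdf n).mul hχ.continuous).integrable_of_hasCompactSupport hχc.mul_left
    · exact ((hf n).continuous.mul hdχ).integrable_of_hasCompactSupport hdχc.mul_left
    · exact ((hf n).continuous.mul hχ.continuous).integrable_of_hasCompactSupport hχc.mul_left
    · exact fun x _ => (hf n).differentiable one_ne_zero x
    · exact fun x _ => hχ1.differentiable one_ne_zero x
  have e4 := tendsto_nhds_unique (e2.congr e3) e1.neg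
  rw [hsub _ hχB] at e4
  simp only [Pi.zero_apply, zero_mul, integral_zero] at e4
  simp only [smul_eq_mul, mul_comm (χ _)]
  linarith

/-- The mean increment of a `C¹` function is bounded by the mean of its derivative. -/
theorem setLIntegral_enorm_add_sub_le {f : E → ℝ} (hf : ContDiff ℝ 1 f) {A B : Set E}
    (hA : MeasurableSet A) (hB : MeasurableSet B) {h : E}
    (hAB : ∀ x ∈ A, ∀ t ∈ Set.Ioc (0 : ℝ) 1, x + t • h ∈ B) :
    ∫⁻ x in A, ‖f (x + h) - f x‖ₑ ∂μ ≤ ‖h‖ₑ * ∫⁻ x in B, ‖fderiv ℝ f x‖ₑ ∂μ := by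
  have hdc : Continuous (fderiv ℝ f) := hf.continuous_fderiv one_ne_zero
  have h1 : ∀ x, ‖f (x + h) - f x‖ₑ ≤ ∫⁻ t in Set.Ioc (0 : ℝ) 1, ‖fderiv ℝ f (x + t • h)‖ₑ * ‖h‖ₑ := by
    intro x
    have hd : ∀ t : ℝ, HasDerivAt (fun t : ℝ => f (x + t • h)) (fderiv ℝ f (x + t • h) h) t := by
      intro t
      have h2 : HasDerivAt (fun t : ℝ => x + t • h) h t := by
        simpa using ((hasDerivAt_id t).smul_const h).const_add x
      exact ((hf.differentiable one_ne_zero _).hasFDerivAt).comp_hasDerivAt t h2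
    have hc : Continuous fun t : ℝ => fderiv ℝ f (x + t • h) h :=
      (hdc.comp (by fun_prop)).clm_apply continuous_const
    have h3 := intervalIntegral.integral_eq_sub_of_hasDerivAt (a := 0) (b := 1) (fun t _ => hd t)
      (hc.intervalIntegrable 0 1)
    simp only [one_smul, zero_smul, add_zero] at h3
    rw [← h3, intervalIntegral.integral_of_le zero_le_one]
    refine (enorm_integral_le_lintegral_enorm _).trans (lintegral_mono fun t => ?_)
    exact ContinuousLinearMap.le_opENorm _ _
  have hm : Measurable fun p : E × ℝ => ‖fderiv ℝ f (p.1 + p.2 • h)‖ₑ * ‖h‖ₑ := by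
    have : Continuous fun p : E × ℝ => fderiv ℝ f (p.1 + p.2 • h) := hdc.comp (by fun_prop)
    exact (this.enorm.measurable).mul_const _
  -- Integrate the derivative along the segment, exchange the integrals, and translate `A` into `B`
  -- for each `t`.
  calc ∫⁻ x in A, ‖f (x + h) - f x‖ₑ ∂μ
      ≤ ∫⁻ x in A, (∫⁻ t in Set.Ioc (0 : ℝ) 1, ‖fderiv ℝ f (x + t • h)‖ₑ * ‖h‖ₑ) ∂μ :=
        lintegral_mono fun x => h1 x
    _ = ∫⁻ t in Set.Ioc (0 : ℝ) 1, ∫⁻ x in A, ‖fderiv ℝ f (x + t • h)‖ₑ * ‖h‖ₑ ∂μ :=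
        lintegral_lintegral_swap hm.aemeasurable
    _ ≤ ∫⁻ t in Set.Ioc (0 : ℝ) 1, ∫⁻ x in B, ‖fderiv ℝ f x‖ₑ * ‖h‖ₑ ∂μ := by
        refine setLIntegral_mono' measurableSet_Ioc fun t ht => ?_
        exact setLIntegral_comp_add_right_le hA hB (fun x hx => hAB x hx t ht)
          fun x => ‖fderiv ℝ f x‖ₑ * ‖h‖ₑ
    _ = ‖h‖ₑ * ∫⁻ x in B, ‖fderiv ℝ f x‖ₑ ∂μ := by
        rw [lintegral_const, lintegral_mul_const' _ _ enorm_ne_top]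
        simp [mul_comm]

/-- A limit in mean of `C¹` functions whose derivatives tend to zero in mean is locally
constant. -/
theorem exists_ae_eq_const_of_tendsto_fderiv {f : ℕ → E → ℝ} (hf : ∀ n, ContDiff ℝ 1 (f n))
    {u : E → ℝ} {c : E} {r : ℝ} (hr : 0 < r)
    (hu : AEStronglyMeasurable u (μ.restrict (Metric.ball c r)))
    (h0 : Tendsto (fun n => ∫⁻ x in Metric.ball c r, ‖f n x - u x‖ₑ ∂μ) atTop (𝓝 0))
    (h1 : Tendsto (fun n => ∫⁻ x in Metric.ball c r, ‖fderiv ℝ (f n) x‖ₑ ∂μ) atTop (𝓝 0)) :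
    ∃ k : ℝ, ∀ᵐ x ∂μ.restrict (Metric.ball c (r / 3)), u x = k := by
  set B := Metric.ball c r with hBdef
  set A := Metric.ball c (r / 3) with hAdef
  have hB : MeasurableSet B := measurableSet_ball
  have hA : MeasurableSet A := measurableSet_ball
  have hAB : A ⊆ B := Metric.ball_subset_ball (by linarith)
  -- A strongly measurable representative makes `v (x + h)` jointly measurable, as the exchange of
  -- quantifiers below requires.
  set v := hu.mk u with hvdef
  have hv : StronglyMeasurable v := hu.stronglyMeasurable_mk
  have huv : u =ᵐ[μ.restrict B] v := hu.ae_eq_mk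
  have h0v : Tendsto (fun n => ∫⁻ x in B, ‖f n x - v x‖ₑ ∂μ) atTop (𝓝 0) := by
    refine h0.congr fun n => lintegral_congr_ae ?_
    filter_upwards [huv] with x hx
    rw [hx]
  have hmove : ∀ h ∈ Metric.ball (0 : E) (2 * r / 3), ∀ t ∈ Set.Icc (0 : ℝ) 1, ∀ x ∈ A,
      x + t • h ∈ B := by
    intro h hh t ht x hx
    rw [Metric.mem_ball, dist_eq_norm] at hx ⊢
    rw [mem_ball_zero_iff] at hh
    have h2 : ‖t • h‖ ≤ ‖h‖ := by
      rw [norm_smul, Real.norm_of_nonneg ht.1]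
      exact mul_le_of_le_one_left (norm_nonneg _) ht.2
    calc ‖x + t • h - c‖ = ‖(x - c) + t • h‖ := by congr 1; abel
      _ ≤ ‖x - c‖ + ‖t • h‖ := norm_add_le _ _
      _ < r := by linarith
  have hshift : ∀ h ∈ Metric.ball (0 : E) (2 * r / 3),
      ∀ᵐ x ∂μ.restrict A, v (x + h) = v x := by
    intro h hh
    have hle : ∀ n, ∫⁻ x in A, ‖v (x + h) - v x‖ₑ ∂μ ≤
        (∫⁻ x in B, ‖f n x - v x‖ₑ ∂μ + ‖h‖ₑ * ∫⁻ x in B, ‖fderiv ℝ (f n) x‖ₑ ∂μ)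
          + ∫⁻ x in B, ‖f n x - v x‖ₑ ∂μ := by
      intro n
      have hfm : Measurable (f n) := (hf n).continuous.measurable
      have hvm := hv.measurable
      have m1 : Measurable fun x => ‖f n (x + h) - v (x + h)‖ₑ :=
        ((hfm.comp (measurable_add_const h)).sub (hvm.comp (measurable_add_const h))).enorm
      have m2 : Measurable fun x => ‖f n (x + h) - f n x‖ₑ :=
        ((hfm.comp (measurable_add_const h)).sub hfm).enorm
      calc ∫⁻ x in A, ‖v (x + h) - v x‖ₑ ∂μ
          ≤ ∫⁻ x in A, (‖f n (x + h) - v (x + h)‖ₑ + ‖f n (x + h) - f n x‖ₑ)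
              + ‖f n x - v x‖ₑ ∂μ := by
            refine lintegral_mono fun x => ?_
            have e : v (x + h) - v x = (-(f n (x + h) - v (x + h)) + (f n (x + h) - f n x))
              + (f n x - v x) := by ring
            rw [e]
            refine (enorm_add_le _ _).trans (add_le_add ((enorm_add_le _ _).trans ?_) le_rfl)
            rw [enorm_neg]
        _ = (∫⁻ x in A, ‖f n (x + h) - v (x + h)‖ₑ ∂μ + ∫⁻ x in A, ‖f n (x + h) - f n x‖ₑ ∂μ)
              + ∫⁻ x in A, ‖f n x - v x‖ₑ ∂μ := by
            rw [lintegral_add_left (f := fun x => ‖f n (x + h) - v (x + h)‖ₑ + ‖f n (x + h) - f n x‖ₑ)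
              (m1.add m2), lintegral_add_left m1]
        _ ≤ _ := by
            refine add_le_add (add_le_add ?_ ?_) (lintegral_mono_set hAB)
            · exact setLIntegral_comp_add_right_le hA hB
                (fun x hx => by simpa using hmove h hh 1 (by simp) x hx)
                fun x => ‖f n x - v x‖ₑ
            · exact setLIntegral_enorm_add_sub_le (hf n) hA hB
                fun x hx t ht => hmove h hh t ⟨ht.1.le, ht.2⟩ x hx
    have hlim : Tendsto (fun n => (∫⁻ x in B, ‖f n x - v x‖ₑ ∂μ
        + ‖h‖ₑ * ∫⁻ x in B, ‖fderiv ℝ (f n) x‖ₑ ∂μ) + ∫⁻ x in B, ‖f n x - v x‖ₑ ∂μ)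
        atTop (𝓝 ((0 + ‖h‖ₑ * 0) + 0)) :=
      (h0v.add (ENNReal.Tendsto.const_mul h1 (Or.inr enorm_ne_top))).add h0v
    simp only [mul_zero, add_zero] at hlim
    have hz : ∫⁻ x in A, ‖v (x + h) - v x‖ₑ ∂μ = 0 :=
      le_antisymm (ge_of_tendsto' hlim hle) (bot_le)
    rw [lintegral_eq_zero_iff] at hz
    · filter_upwards [hz] with x hx
      simpa [sub_eq_zero] using hx
    · exact ((hv.measurable.comp (measurable_add_const h)).sub hv.measurable).enorm
  -- Fubini: invariance for each `h` and almost every `x` becomes, for a single good `x`, invariance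
  -- for almost every `h`.
  have hswap : ∀ᵐ x ∂μ.restrict A, ∀ᵐ h ∂μ.restrict (Metric.ball (0 : E) (2 * r / 3)),
      v (x + h) = v x := by
    rw [Measure.ae_ae_comm]
    · rw [ae_restrict_iff' measurableSet_ball]
      exact Eventually.of_forall hshift
    · exact measurableSet_eq_fun (hv.measurable.comp measurable_add)
        (hv.measurable.comp measurable_fst)
  have hne : (ae (μ.restrict A)).NeBot := by
    rw [ae_neBot, Ne, Measure.restrict_eq_zero]
    exact (Metric.measure_ball_pos μ c (by positivity)).ne'
  obtain ⟨x, hx, hxA⟩ := (hswap.and (ae_restrict_mem hA)).exists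
  refine ⟨v x, ?_⟩
  rw [ae_restrict_iff' measurableSet_ball] at hx
  -- Two points of the ball of radius `r / 3` differ by less than `2 * r / 3`, so the shifts of the
  -- good `x` reach all of `A`.
  have h2 : ∀ᵐ y ∂μ, y - x ∈ Metric.ball (0 : E) (2 * r / 3) → v (x + (y - x)) = v x :=
    (measurePreserving_sub_right μ x).quasiMeasurePreserving.ae hx
  filter_upwards [ae_restrict_of_ae h2, ae_restrict_mem hA, ae_restrict_of_ae_restrict_of_subset hAB huv] with y hy hyA hyu
  rw [hyu]
  rw [add_sub_cancel] at hy
  apply hy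
  rw [mem_ball_zero_iff, ← dist_eq_norm]
  rw [hAdef, Metric.mem_ball] at hyA hxA
  linarith [dist_triangle_right y x c]

end Euclidean
end SurfaceObstacle

/-! ### Charts, tangent planes and normals of a smooth surface. -/

namespace SurfaceObstacle

/-- The Euclidean plane, in which surfaces are parametrized. -/
abbrev R2 : Type := EuclideanSpace ℝ (Fin 2)

/-- A bi-Lipschitz parametrization `ψ` of the open part `M ∩ O` of `M` by the disc of centre `c` and
radius `r`, with inverse `θ`. -/
structure LocalParametrization (M : Set R3) where
  ψ : R2 → R3
  θ : R3 → R2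
  c : R2
  r : ℝ
  K : NNReal
  O : Set R3
  r_pos : 0 < r
  contDiff : ContDiff ℝ ∞ ψ
  isOpen : IsOpen O
  lipschitz : LipschitzOnWith K ψ (Metric.ball c r)
  lipschitz_inv : LipschitzOnWith K θ O
  mapsTo : ∀ y ∈ Metric.ball c r, ψ y ∈ M ∩ O
  left_inv : ∀ y ∈ Metric.ball c r, θ (ψ y) = y
  mapsTo_inv : ∀ x ∈ M ∩ O, θ x ∈ Metric.ball c r
  right_inv : ∀ x ∈ M ∩ O, ψ (θ x) = x
  differentiableAt_inv : ∀ x ∈ O, DifferentiableAt ℝ θ x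

/-- The inclusion of the plane `{x | x 2 = 0}`. -/
def planeIncl (y : R2) : R3 := !₂[y 0, y 1, 0]

/-- The projection to the first two coordinates. -/
def planeProj (x : R3) : R2 := !₂[x 0, x 1]

theorem contDiff_planeIncl {n : WithTop ℕ∞} : ContDiff ℝ n planeIncl := by
  rw [contDiff_euclidean]
  intro i
  fin_cases i <;> simp only [planeIncl] <;> simp <;> fun_prop

theorem contDiff_planeProj {n : WithTop ℕ∞} : ContDiff ℝ n planeProj := by
  rw [contDiff_euclidean]
  intro i
  fin_cases i <;> simp only [planeProj] <;> simp <;> fun_prop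

theorem planeProj_planeIncl (y : R2) : planeProj (planeIncl y) = y := by
  ext i; fin_cases i <;> simp [planeProj, planeIncl]

theorem planeIncl_planeProj {x : R3} (hx : x 2 = 0) : planeIncl (planeProj x) = x := by
  ext i; fin_cases i <;> simp [planeProj, planeIncl, hx]

theorem planeIncl_apply_two (y : R2) : planeIncl y 2 = 0 := by simp [planeIncl]

theorem IsSmoothSurface.exists_localParametrization {M : Set R3} (hM : IsSmoothSurface M) {p : R3}
    (hp : p ∈ M) : ∃ P : LocalParametrization M, p ∈ P.O ∧ P.θ p = P.c := by
  obtain ⟨Φ, hpΦ, hΦ, hΦs, hΦM⟩ := hM p hp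
  have hp2 : Φ p 2 = 0 := (hΦM p hpΦ).1 hp
  set c : R2 := planeProj (Φ p) with hc
  have hιc : planeIncl c = Φ p := planeIncl_planeProj hp2
  set U : Set R2 := planeIncl ⁻¹' Φ.target with hU
  have hUo : IsOpen U := Φ.open_target.preimage (contDiff_planeIncl (n := 0)).continuous
  have hcU : c ∈ U := by rw [hU, Set.mem_preimage, hιc]; exact Φ.map_source hpΦ
  obtain ⟨R, hR, hRU⟩ := Metric.isOpen_iff.1 hUo c hcU
  -- The cutoff makes `ψ` smooth on the whole plane, so that `φ ∘ ψ` is globally smooth as the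
  -- Euclidean lemmas demand.
  let χ : ContDiffBump c := ⟨R / 3, R / 2, by positivity, by linarith⟩
  let ψ₀ : R2 → R3 := fun y => Φ.symm (planeIncl y)
  let ψ : R2 → R3 := fun y => χ y • ψ₀ y
  have hψ₀ : ∀ y ∈ U, ContDiffAt ℝ ∞ ψ₀ y := fun y hy =>
    (hΦs.contDiffAt (Φ.open_target.mem_nhds hy)).comp y contDiff_planeIncl.contDiffAt
  have hψ : ContDiff ℝ ∞ ψ := by
    rw [contDiff_iff_contDiffAt]
    intro y
    by_cases hy : y ∈ U
    · exact χ.contDiff.contDiffAt.smul (hψ₀ y hy)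
    · have hy2 : y ∈ (Metric.closedBall c (R / 2))ᶜ := fun h =>
        hy (hRU (Metric.closedBall_subset_ball (by linarith) h))
      refine (contDiffAt_const (c := (0 : R3))).congr_of_eventuallyEq ?_
      filter_upwards [Metric.isClosed_closedBall.isOpen_compl.mem_nhds hy2] with z hz
      have : χ z = 0 := χ.zero_of_le_dist (le_of_lt (by simpa using hz))
      simp [ψ, this]
  have hψeq : ∀ y ∈ Metric.ball c (R / 3), ψ y = Φ.symm (planeIncl y) := fun y hy => by
    have : χ y = 1 := χ.one_of_mem_closedBall (Metric.ball_subset_closedBall hy)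
    simp [ψ, ψ₀, this]
  have hψc : ψ c = p := by
    rw [hψeq c (Metric.mem_ball_self (by positivity)), hιc, Φ.left_inv hpΦ]
  let θ : R3 → R2 := fun x => planeProj (Φ x)
  have hθp : θ p = c := hc.symm
  have hθ : ∀ x ∈ Φ.source, ContDiffAt ℝ ∞ θ x := fun x hx =>
    contDiff_planeProj.contDiffAt.comp x (hΦ.contDiffAt (Φ.open_source.mem_nhds hx))
  obtain ⟨K₁, t₁, ht₁, hK₁⟩ :=
    (hψ.contDiffAt (x := c)).of_le (m := 1) (by simp) |>.exists_lipschitzOnWith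
  obtain ⟨K₂, t₂, ht₂, hK₂⟩ :=
    (hθ p hpΦ).of_le (m := 1) (by simp) |>.exists_lipschitzOnWith
  set O₁ := interior t₂ ∩ Φ.source with hO₁
  have hO₁o : IsOpen O₁ := isOpen_interior.inter Φ.open_source
  have hpO₁ : p ∈ O₁ := ⟨mem_interior_iff_mem_nhds.2 ht₂, hpΦ⟩
  have hnhds : t₁ ∩ (Metric.ball c (R / 3) ∩ ψ ⁻¹' O₁) ∈ 𝓝 c := by
    refine inter_mem ht₁ (inter_mem (Metric.ball_mem_nhds c (by positivity)) ?_)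
    exact hψ.continuous.continuousAt.preimage_mem_nhds (by rw [hψc]; exact hO₁o.mem_nhds hpO₁)
  -- On this disc `ψ` is Lipschitz, the cutoff equals `1`, and the image stays where `θ` is
  -- Lipschitz. Intersecting `O₁` with the preimage of the disc under `θ` makes `M ∩ O` exactly the
  -- image of the disc.
  obtain ⟨r, hr, hrs⟩ := Metric.mem_nhds_iff.1 hnhds
  have hθc : ContinuousOn θ O₁ := fun x hx => (hθ x hx.2).continuousAt.continuousWithinAt
  have hleft : ∀ y ∈ Metric.ball c r, θ (ψ y) = y ∧ ψ y ∈ M := by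
    intro y hy
    have hy3 := (hrs hy).2.1
    have hyU : y ∈ U := hRU (Metric.ball_subset_ball (by linarith) hy3)
    have h1 : Φ (ψ y) = planeIncl y := by rw [hψeq y hy3, Φ.right_inv hyU]
    refine ⟨by simp only [θ, h1, planeProj_planeIncl], ?_⟩
    rw [hΦM _ (hrs hy).2.2.2, h1, planeIncl_apply_two]
  refine ⟨⟨ψ, θ, c, r, max K₁ K₂, O₁ ∩ θ ⁻¹' Metric.ball c r, hr, hψ,
    hθc.isOpen_inter_preimage hO₁o Metric.isOpen_ball,
    (hK₁.mono fun y hy => (hrs hy).1).weaken (le_max_left _ _),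
    (hK₂.mono fun x hx => interior_subset hx.1.1).weaken (le_max_right _ _),
    fun y hy => ⟨(hleft y hy).2, (hrs hy).2.2, ?_⟩, fun y hy => (hleft y hy).1,
    fun x hx => hx.2.2, fun x hx => ?_, fun x hx => ?_⟩, ⟨hpO₁, ?_⟩, hθp⟩
  · rw [Set.mem_preimage, (hleft y hy).1]; exact hy
  · have h2 : Φ x 2 = 0 := (hΦM x hx.2.1.2).1 hx.1
    rw [hψeq _ (hrs hx.2.2).2.1]
    simp only [θ]
    rw [planeIncl_planeProj h2, Φ.left_inv hx.2.1.2]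
  · exact (hθ x hx.1.2).differentiableAt (by simp)
  · rw [Set.mem_preimage, hθp]
    exact Metric.mem_ball_self hr

/-- Near each of its points, a smooth surface has a continuous normal field. -/
theorem IsSmoothSurface.exists_normal {M : Set R3} (hM : IsSmoothSurface M) {p : R3}
    (hp : p ∈ M) : ∃ (O : Set R3) (n : R3 → R3), IsOpen O ∧ p ∈ O ∧ ContinuousOn n O ∧
      ∀ x ∈ M ∩ O, n x ≠ 0 ∧ tangentPlane M x = (Submodule.span ℝ {n x})ᗮ := by
  obtain ⟨Φ, hpΦ, hΦ, hΦs, hΦM⟩ := hM p hp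
  -- The third coordinate of the flattening is a local defining function of `M`, and its gradient is
  -- the normal.
  let f : R3 → ℝ := fun x => Φ x 2
  have hf : ContDiffOn ℝ ∞ f Φ.source := (contDiffOn_euclidean.1 hΦ) 2
  have hfd : ContinuousOn (fderiv ℝ f) Φ.source :=
    hf.continuousOn_fderiv_of_isOpen Φ.open_source (by simp)
  have hΦd : ∀ x ∈ Φ.source, DifferentiableAt ℝ Φ x := fun x hx =>
    (hΦ.contDiffAt (Φ.open_source.mem_nhds hx)).differentiableAt (by simp)
  have hΦsd : ∀ y ∈ Φ.target, DifferentiableAt ℝ Φ.symm y := fun y hy =>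
    (hΦs.contDiffAt (Φ.open_target.mem_nhds hy)).differentiableAt (by simp)
  have hinner : ∀ x v, inner ℝ (gradient f x) v = fderiv ℝ f x v := fun x v => inner_gradient_left
  have hfΦ : ∀ x ∈ Φ.source, ∀ v, fderiv ℝ f x v = fderiv ℝ Φ x v 2 := fun x hx v => by
    have h : HasFDerivAt f _ x :=
      (EuclideanSpace.proj (2 : Fin 3) : R3 →L[ℝ] ℝ).hasFDerivAt.comp x (hΦd x hx).hasFDerivAt
    rw [h.fderiv]
    rfl
  have hright : ∀ x ∈ Φ.source, ∀ v, fderiv ℝ Φ x (fderiv ℝ Φ.symm (Φ x) v) = v := by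
    intro x hx v
    have hy := Φ.map_source hx
    have h1 : HasFDerivAt Φ (fderiv ℝ Φ x) (Φ.symm (Φ x)) := by
      rw [Φ.left_inv hx]; exact (hΦd x hx).hasFDerivAt
    have h2 := h1.comp (Φ x) (hΦsd _ hy).hasFDerivAt
    have h3 : Φ ∘ Φ.symm =ᶠ[𝓝 (Φ x)] id := Φ.eventually_right_inverse hy
    have h4 := (h3.hasFDerivAt_iff.1 h2).unique (hasFDerivAt_id _)
    exact congrArg (fun L : R3 →L[ℝ] R3 => L v) h4
  have hleft : ∀ x ∈ Φ.source, ∀ v, fderiv ℝ Φ.symm (Φ x) (fderiv ℝ Φ x v) = v := by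
    intro x hx v
    have h2 := (hΦsd _ (Φ.map_source hx)).hasFDerivAt.comp x (hΦd x hx).hasFDerivAt
    have h3 : Φ.symm ∘ Φ =ᶠ[𝓝 x] id := Φ.eventually_left_inverse hx
    have h4 := (h3.hasFDerivAt_iff.1 h2).unique (hasFDerivAt_id _)
    exact congrArg (fun L : R3 →L[ℝ] R3 => L v) h4
  refine ⟨Φ.source, gradient f, Φ.open_source, hpΦ, ?_, fun x hx => ⟨?_, ?_⟩⟩
  · exact (LinearIsometryEquiv.continuous _).comp_continuousOn hfd
  · intro h0
    have h1 := hinner x (fderiv ℝ Φ.symm (Φ x) (EuclideanSpace.single 2 1))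
    rw [h0, hfΦ x hx.2, hright x hx.2] at h1
    simp at h1
  · apply le_antisymm
    · rw [tangentPlane, Submodule.span_le]
      rintro v ⟨γ, hγ0, hγM, hγ⟩
      rw [SetLike.mem_coe, Submodule.mem_orthogonal_singleton_iff_inner_right, hinner]
      have hfx : HasFDerivAt f (fderiv ℝ f x) (γ 0) := by
        rw [hγ0]
        exact ((hf.contDiffAt (Φ.open_source.mem_nhds hx.2)).differentiableAt (by simp)).hasFDerivAt
      have h1 := hfx.comp_hasDerivAt 0 hγ
      have h2 : f ∘ γ =ᶠ[𝓝 0] fun _ => 0 := by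
        have h3 : ∀ᶠ t in 𝓝 0, γ t ∈ Φ.source :=
          hγ.continuousAt.preimage_mem_nhds (by rw [hγ0]; exact Φ.open_source.mem_nhds hx.2)
        filter_upwards [hγM, h3] with t h4 h5
        exact (hΦM _ h5).1 h4
      exact h1.unique ((hasDerivAt_const 0 (0 : ℝ)).congr_of_eventuallyEq h2)
    · intro v hv
      rw [Submodule.mem_orthogonal_singleton_iff_inner_right, hinner, hfΦ x hx.2] at hv
      apply Submodule.subset_span
      have hl : HasDerivAt (fun t : ℝ => Φ x + t • fderiv ℝ Φ x v) (fderiv ℝ Φ x v) 0 := by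
        simpa using ((hasDerivAt_id (0 : ℝ)).smul_const (fderiv ℝ Φ x v)).const_add (Φ x)
      -- The straight line in the flattened picture stays in the plane, since `v` is killed by the
      -- differential of `f`; pulled back, it is a curve in `M` with velocity `v`.
      refine ⟨fun t => Φ.symm (Φ x + t • fderiv ℝ Φ x v), by simp [Φ.left_inv hx.2], ?_, ?_⟩
      · have h3 : ∀ᶠ t in 𝓝 (0 : ℝ), Φ x + t • fderiv ℝ Φ x v ∈ Φ.target :=
          hl.continuousAt.preimage_mem_nhds
            (by simpa using Φ.open_target.mem_nhds (Φ.map_source hx.2))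
        filter_upwards [h3] with t ht
        rw [hΦM _ (Φ.map_target ht), Φ.right_inv ht]
        have := (hΦM x hx.2).1 hx.1
        simp [hv, this]
      · have h4 : HasFDerivAt Φ.symm (fderiv ℝ Φ.symm (Φ x))
            (Φ x + (0 : ℝ) • fderiv ℝ Φ x v) := by
          simpa using (hΦsd _ (Φ.map_source hx.2)).hasFDerivAt
        have h5 := h4.comp_hasDerivAt 0 hl
        rwa [hleft x hx.2] at h5

theorem continuous_gradient {φ : R3 → ℝ} (hφ : ContDiff ℝ ∞ φ) : Continuous (gradient φ) :=
  (LinearIsometryEquiv.continuous _).comp (hφ.continuous_fderiv (by simp))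

/-- Projecting to the tangent plane subtracts the component along a continuous nonvanishing normal.
This supplies the measurability and boundedness of tangential gradients. -/
theorem IsSmoothSurface.continuousOn_tangentialGrad {M : Set R3} (hM : IsSmoothSurface M)
    {φ : R3 → ℝ} (hφ : ContDiff ℝ ∞ φ) : ContinuousOn (tangentialGrad M φ) M := by
  intro p hp
  obtain ⟨O, n, hO, hpO, hn, h⟩ := hM.exists_normal hp
  have hg := continuous_gradient hφ
  have h1 : ContinuousOn (fun x => gradient φ x - (inner ℝ (n x) (gradient φ x) / ‖n x‖ ^ 2) • n x)
      (M ∩ O) := by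
    have hn' : ContinuousOn n (M ∩ O) := hn.mono Set.inter_subset_right
    have hq : ContinuousOn (fun x => inner ℝ (n x) (gradient φ x) / ‖n x‖ ^ 2) (M ∩ O) := by
      refine (hn'.inner hg.continuousOn).div (hn'.norm.pow 2) fun x hx => ?_
      have := norm_ne_zero_iff.2 (h x hx).1
      positivity
    exact hg.continuousOn.sub (hq.smul hn')
  have h2 : ContinuousOn (tangentialGrad M φ) (M ∩ O) := by
    refine h1.congr fun x hx => ?_
    rw [tangentialGrad]
    simp only [(h x hx).2]
    rw [Submodule.starProjection_orthogonal, sub_apply,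
      Submodule.starProjection_singleton]
    simp
  have h3 := h2 p ⟨hp, hpO⟩
  rwa [continuousWithinAt_inter (hO.mem_nhds hpO)] at h3

namespace LocalParametrization

variable {M : Set R3} (P : LocalParametrization M)

theorem fderiv_mem_tangentPlane {y : R2} (hy : y ∈ Metric.ball P.c P.r) (e : R2) :
    fderiv ℝ P.ψ y e ∈ tangentPlane M (P.ψ y) := by
  apply Submodule.subset_span
  have hl : HasDerivAt (fun t : ℝ => y + t • e) e 0 := by
    simpa using ((hasDerivAt_id (0 : ℝ)).smul_const e).const_add y
  refine ⟨fun t => P.ψ (y + t • e), by simp, ?_, ?_⟩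
  · have : ∀ᶠ t in 𝓝 (0 : ℝ), y + t • e ∈ Metric.ball P.c P.r :=
      hl.continuousAt.preimage_mem_nhds (by simpa using Metric.isOpen_ball.mem_nhds hy)
    filter_upwards [this] with t ht using (P.mapsTo _ ht).1
  · have h4 : HasFDerivAt P.ψ (fderiv ℝ P.ψ y) (y + (0 : ℝ) • e) := by
      simpa using (P.contDiff.differentiable (by simp) y).hasFDerivAt
    exact h4.comp_hasDerivAt 0 hl

/-- `ψ ∘ θ` fixes the curves in `M`, whose velocities span the tangent plane. Hence the derivative
of `ψ` is onto the tangent plane. -/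
theorem fderiv_fderiv_inv {y : R2} (hy : y ∈ Metric.ball P.c P.r) {v : R3}
    (hv : v ∈ tangentPlane M (P.ψ y)) : fderiv ℝ P.ψ y (fderiv ℝ P.θ (P.ψ y) v) = v := by
  rw [tangentPlane] at hv
  induction hv using Submodule.span_induction with
  | zero => simp
  | add a b _ _ ha hb => rw [map_add, map_add, ha, hb]
  | smul s a _ ha => rw [map_smul, map_smul, ha]
  | mem v hv =>
    obtain ⟨γ, hγ0, hγM, hγ⟩ := hv
    have hθ : HasFDerivAt P.θ (fderiv ℝ P.θ (P.ψ y)) (γ 0) := by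
      rw [hγ0]; exact (P.differentiableAt_inv _ (P.mapsTo y hy).2).hasFDerivAt
    have h1 := hθ.comp_hasDerivAt 0 hγ
    have hψ : HasFDerivAt P.ψ (fderiv ℝ P.ψ y) ((P.θ ∘ γ) 0) := by
      rw [Function.comp_apply, hγ0, P.left_inv y hy]
      exact (P.contDiff.differentiable (by simp) y).hasFDerivAt
    have h2 := hψ.comp_hasDerivAt 0 h1
    have h3 : P.ψ ∘ P.θ ∘ γ =ᶠ[𝓝 0] γ := by
      have h3 : ∀ᶠ t in 𝓝 0, γ t ∈ P.O :=
        hγ.continuousAt.preimage_mem_nhds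
          (by rw [hγ0]; exact P.isOpen.mem_nhds (P.mapsTo y hy).2)
      filter_upwards [hγM, h3] with t h4 h5
      exact P.right_inv _ ⟨h4, h5⟩
    exact (hγ.congr_of_eventuallyEq h3).unique h2 |>.symm

/-- The derivative of a function in the parametrization is given by its tangential gradient. -/
theorem fderiv_comp_apply {φ : R3 → ℝ} (hφ : ContDiff ℝ ∞ φ) {y : R2}
    (hy : y ∈ Metric.ball P.c P.r) (e : R2) :
    fderiv ℝ (fun z => φ (P.ψ z)) y e
      = inner ℝ (tangentialGrad M φ (P.ψ y)) (fderiv ℝ P.ψ y e) := by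
  have h1 : HasFDerivAt (fun z => φ (P.ψ z)) ((fderiv ℝ φ (P.ψ y)).comp (fderiv ℝ P.ψ y)) y :=
    (hφ.differentiable (by simp) _).hasFDerivAt.comp y
      (P.contDiff.differentiable (by simp) y).hasFDerivAt
  rw [h1.fderiv, ContinuousLinearMap.comp_apply, ← inner_gradient_left, tangentialGrad,
    Submodule.inner_starProjection_left_eq_right,
    Submodule.starProjection_eq_self_iff.2 (P.fderiv_mem_tangentPlane hy e)]

theorem norm_fderiv_le {y : R2} (hy : y ∈ Metric.ball P.c P.r) : ‖fderiv ℝ P.ψ y‖ ≤ P.K :=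
  norm_fderiv_le_of_lipschitzOn ℝ (Metric.isOpen_ball.mem_nhds hy) P.lipschitz

end LocalParametrization
end SurfaceObstacle

/-! ### Transfer of closability and constancy from the disc to the surface. -/

namespace SurfaceObstacle

theorem euclideanHausdorffMeasure_image_le_of_lipschitzOnWith {X Y : Type*} [EMetricSpace X]
    [EMetricSpace Y] [MeasurableSpace X] [BorelSpace X] [MeasurableSpace Y] [BorelSpace Y]
    {K : NNReal} {f : X → Y} {s : Set X} (h : LipschitzOnWith K f s) (d : ℕ) :
    Measure.euclideanHausdorffMeasure d (f '' s)
      ≤ (K : ℝ≥0∞) ^ d * Measure.euclideanHausdorffMeasure d s := by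
  have h1 := h.hausdorffMeasure_image_le (d := d) (Nat.cast_nonneg d)
  rw [ENNReal.rpow_natCast] at h1
  simp only [Measure.euclideanHausdorffMeasure_def, Measure.smul_apply, ENNReal.smul_def,
    smul_eq_mul]
  rw [mul_left_comm]
  gcongr

namespace LocalParametrization

variable {M : Set R3} (P : LocalParametrization M)

/-- Comparison of area and Lebesgue measure up to the factor `K ^ 2`, here and in
`volume_le_area_image`, suffices: only null sets, finiteness and convergence to zero are
transferred. -/
theorem area_image_le {s : Set R2} (hs : s ⊆ Metric.ball P.c P.r) :
    area M (P.ψ '' s) ≤ (P.K : ℝ≥0∞) ^ 2 * volume s := by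
  rw [← EuclideanSpace.euclideanHausdorffMeasure_eq_volume]
  exact (Measure.restrict_apply_le _ _).trans
    (euclideanHausdorffMeasure_image_le_of_lipschitzOnWith (P.lipschitz.mono hs) 2)

theorem volume_le_area_image {s : Set R2} (hs : s ⊆ Metric.ball P.c P.r) :
    volume s ≤ (P.K : ℝ≥0∞) ^ 2 * area M (P.ψ '' s) := by
  have h1 : P.ψ '' s ⊆ M := by
    rintro _ ⟨y, hy, rfl⟩; exact (P.mapsTo y (hs hy)).1
  have h2 : P.ψ '' s ⊆ P.O := by
    rintro _ ⟨y, hy, rfl⟩; exact (P.mapsTo y (hs hy)).2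
  have h3 : P.θ '' (P.ψ '' s) = s := by
    rw [Set.image_image]
    exact (Set.image_congr fun y hy => P.left_inv y (hs hy)).trans (Set.image_id _)
  rw [← EuclideanSpace.euclideanHausdorffMeasure_eq_volume, area, Measure.restrict_eq_self _ h1]
  conv_lhs => rw [← h3]
  exact euclideanHausdorffMeasure_image_le_of_lipschitzOnWith (P.lipschitz_inv.mono h2) 2

theorem map_volume_le :
    (volume.restrict (Metric.ball P.c P.r)).map P.ψ ≤ (P.K : ℝ≥0∞) ^ 2 • area M := by
  have hψ : Measurable P.ψ := P.contDiff.continuous.measurable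
  refine Measure.le_iff.2 fun A hA => ?_
  rw [Measure.map_apply hψ hA, Measure.restrict_apply (hψ hA), Measure.smul_apply, smul_eq_mul]
  refine (P.volume_le_area_image Set.inter_subset_right).trans ?_
  gcongr
  rintro _ ⟨y, hy, rfl⟩
  exact hy.1

theorem quasiMeasurePreserving :
    Measure.QuasiMeasurePreserving P.ψ (volume.restrict (Metric.ball P.c P.r)) (area M) :=
  ⟨P.contDiff.continuous.measurable,
    (Measure.absolutelyContinuous_of_le P.map_volume_le).trans
      (Measure.smul_absolutelyContinuous)⟩

theorem lintegral_comp_le {F : R3 → ℝ≥0∞} (hF : AEMeasurable F (area M)) :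
    ∫⁻ y in Metric.ball P.c P.r, F (P.ψ y) ≤ (P.K : ℝ≥0∞) ^ 2 * ∫⁻ x, F x ∂area M := by
  rw [← lintegral_map' (hF.mono_ac P.quasiMeasurePreserving.absolutelyContinuous)
    P.contDiff.continuous.aemeasurable, ← smul_eq_mul, ← lintegral_smul_measure]
  exact lintegral_mono' P.map_volume_le le_rfl

/-- A property that holds almost everywhere on a part of the disc of parameters holds almost
everywhere on the corresponding part of the surface. -/
theorem ae_area {p : R3 → Prop} {ρ : ℝ} (hρ : ρ ≤ P.r)
    (h : ∀ᵐ y ∂volume.restrict (Metric.ball P.c ρ), p (P.ψ y)) :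
    area M {x | (x ∈ M ∩ P.O ∧ P.θ x ∈ Metric.ball P.c ρ) ∧ ¬ p x} = 0 := by
  have hsub : Metric.ball P.c ρ ⊆ Metric.ball P.c P.r := Metric.ball_subset_ball hρ
  rw [ae_restrict_iff' measurableSet_ball, ae_iff] at h
  have h1 : {y | ¬ (y ∈ Metric.ball P.c ρ → p (P.ψ y))} ⊆ Metric.ball P.c P.r := fun y hy =>
    hsub (Classical.not_imp.1 hy).1
  have h2 := P.area_image_le h1
  rw [h, mul_zero] at h2
  refine measure_mono_null ?_ (le_antisymm h2 bot_le)
  rintro x ⟨⟨hx, hxρ⟩, hp⟩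
  exact ⟨P.θ x, by
    refine Classical.not_imp.2 ⟨hxρ, ?_⟩
    rwa [P.right_inv x hx], P.right_inv x hx⟩

theorem nhdsWithin_mem {p : R3} (hp : p ∈ M ∩ P.O) {ρ : ℝ} (hpρ : P.θ p ∈ Metric.ball P.c ρ) :
    {x | x ∈ M ∩ P.O ∧ P.θ x ∈ Metric.ball P.c ρ} ∈ 𝓝[M] p := by
  have h1 : ∀ᶠ x in 𝓝 p, P.θ x ∈ Metric.ball P.c ρ :=
    (P.differentiableAt_inv p hp.2).continuousAt.preimage_mem_nhds
      (Metric.isOpen_ball.mem_nhds hpρ)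
  filter_upwards [self_mem_nhdsWithin, nhdsWithin_le_nhds h1,
    nhdsWithin_le_nhds (P.isOpen.mem_nhds hp.2)] with x hx h2 h3
  exact ⟨⟨hx, h3⟩, h2⟩

end LocalParametrization

theorem measurableSet_of_isCompact {M : Set R3} (hMc : IsCompact M) : MeasurableSet M :=
  hMc.isClosed.measurableSet

theorem IsSmoothSurface.isFiniteMeasure_area {M : Set R3} (hM : IsSmoothSurface M)
    (hMc : IsCompact M) : IsFiniteMeasure (area M) := by
  refine ⟨?_⟩
  have h1 : area M M < ⊤ := by
    refine hMc.measure_lt_top_of_nhdsWithin fun p hp => ?_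
    obtain ⟨P, hpO, hpc⟩ := hM.exists_localParametrization hp
    refine ⟨_, P.nhdsWithin_mem ⟨hp, hpO⟩ (ρ := P.r)
      (by rw [hpc]; exact Metric.mem_ball_self P.r_pos), ?_⟩
    have h2 : {x | x ∈ M ∩ P.O ∧ P.θ x ∈ Metric.ball P.c P.r} ⊆ P.ψ '' Metric.ball P.c P.r :=
      fun x hx => ⟨P.θ x, hx.2, P.right_inv x hx.1⟩
    refine (measure_mono h2).trans_lt ((P.area_image_le le_rfl).trans_lt ?_)
    exact ENNReal.mul_lt_top (by simp) measure_ball_lt_top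
  rwa [area, Measure.restrict_apply_univ, ← Measure.restrict_apply_self]

/-- Nonempty relatively open subsets of a surface have positive area. -/
theorem IsSmoothSurface.area_ne_zero_of_mem_nhdsWithin {M : Set R3} (hM : IsSmoothSurface M)
    {p : R3} (hp : p ∈ M) {s : Set R3} (hs : s ∈ 𝓝[M] p) : area M s ≠ 0 := by
  obtain ⟨P, hpO, hpc⟩ := hM.exists_localParametrization hp
  have hψc : P.ψ P.c = p := by rw [← hpc, P.right_inv p ⟨hp, hpO⟩]
  obtain ⟨U, hU, hUs⟩ := mem_nhdsWithin_iff_exists_mem_nhds_inter.1 hs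
  have h1 : P.ψ ⁻¹' U ∩ Metric.ball P.c P.r ∈ 𝓝 P.c :=
    inter_mem (P.contDiff.continuous.continuousAt.preimage_mem_nhds (by rwa [hψc]))
      (Metric.ball_mem_nhds _ P.r_pos)
  intro h0
  have h2 := P.volume_le_area_image (s := P.ψ ⁻¹' U ∩ Metric.ball P.c P.r) Set.inter_subset_right
  have h3 : area M (P.ψ '' (P.ψ ⁻¹' U ∩ Metric.ball P.c P.r)) = 0 := by
    refine measure_mono_null ?_ h0
    rintro _ ⟨y, hy, rfl⟩
    exact hUs ⟨hy.1, (P.mapsTo y hy.2).1⟩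
  rw [h3, mul_zero] at h2
  exact (Measure.measure_pos_of_mem_nhds volume h1).ne' (le_antisymm h2 bot_le)

theorem ae_mem_area {M : Set R3} (hMc : IsCompact M) : ∀ᵐ x ∂area M, x ∈ M :=
  ae_restrict_mem (measurableSet_of_isCompact hMc)

theorem IsSmoothSurface.aestronglyMeasurable_tangentialGrad {M : Set R3} (hM : IsSmoothSurface M)
    (hMc : IsCompact M) {φ : R3 → ℝ} (hφ : ContDiff ℝ ∞ φ) :
    AEStronglyMeasurable (tangentialGrad M φ) (area M) :=
  (hM.continuousOn_tangentialGrad hφ).aestronglyMeasurable (measurableSet_of_isCompact hMc)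

/-- The tangential gradient is closable. -/
theorem IsSmoothSurface.ae_eq_zero_of_tendsto_tangentialGrad {M : Set R3}
    (hM : IsSmoothSurface M) (hMc : IsCompact M) {φ : ℕ → R3 → ℝ}
    (hφ : ∀ n, ContDiff ℝ ∞ (φ n)) {G : R3 → R3} (hG : Integrable G (area M))
    (h0 : Tendsto (fun n => ∫⁻ x, ‖φ n x‖ₑ ∂area M) atTop (𝓝 0))
    (h1 : Tendsto (fun n => ∫⁻ x, ‖tangentialGrad M (φ n) x - G x‖ₑ ∂area M) atTop (𝓝 0)) :
    ∀ᵐ x ∂area M, G x = 0 := by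
  have hgm := fun n => hM.aestronglyMeasurable_tangentialGrad hMc (hφ n)
  -- the limit is tangential
  have hGT : ∀ᵐ x ∂area M, G x ∈ tangentPlane M x := by
    have h2 : TendstoInMeasure (area M) (fun n => tangentialGrad M (φ n)) atTop G := by
      refine tendstoInMeasure_of_tendsto_eLpNorm one_ne_zero hgm hG.aestronglyMeasurable ?_
      simpa only [eLpNorm_one_eq_lintegral_enorm, Pi.sub_apply] using h1
    obtain ⟨ns, -, hns⟩ := h2.exists_seq_tendsto_ae
    filter_upwards [hns] with x hx
    refine (Submodule.closed_of_finiteDimensional (tangentPlane M x)).mem_of_tendsto hx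
      (Eventually.of_forall fun n => ?_)
    exact Submodule.starProjection_apply_mem _ _
  refine measure_null_of_locally_null _ fun p hp => ?_
  by_cases hpM : p ∈ M
  swap
  · refine ⟨Mᶜ, mem_nhdsWithin_of_mem_nhds (hMc.isClosed.isOpen_compl.mem_nhds hpM), ?_⟩
    exact ae_mem_area hMc
  obtain ⟨P, hpO, hpc⟩ := hM.exists_localParametrization hpM
  set B := Metric.ball P.c P.r with hB
  -- In the chart, the derivatives of `φ n ∘ ψ` along `e` converge in mean to this inner product
  -- while the functions tend to zero, so Euclidean closability applies.
  have hcomp : ∀ e : R2, ∀ᵐ y ∂volume.restrict B, inner ℝ (G (P.ψ y)) (fderiv ℝ P.ψ y e) = 0 := by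
    intro e
    have hbd : ∀ w : R3, ∀ y ∈ B, ‖inner ℝ w (fderiv ℝ P.ψ y e)‖ₑ ≤ (P.K : ℝ≥0∞) * ‖e‖ₑ * ‖w‖ₑ := by
      intro w y hy
      have h2 : ‖inner ℝ w (fderiv ℝ P.ψ y e)‖ ≤ P.K * ‖e‖ * ‖w‖ := by
        refine (norm_inner_le_norm _ _).trans ?_
        have := ((fderiv ℝ P.ψ y).le_opNorm e).trans
          (mul_le_mul_of_nonneg_right (P.norm_fderiv_le hy) (norm_nonneg e))
        rw [mul_comm]
        gcongr
      have h3 := ENNReal.ofReal_le_ofReal h2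
      rwa [ENNReal.ofReal_mul (by positivity), ENNReal.ofReal_mul (by positivity), ofReal_norm,
        ofReal_norm, ofReal_norm, ENNReal.ofReal_coe_nnreal] at h3
    have hdψ : Continuous fun y => fderiv ℝ P.ψ y e :=
      (P.contDiff.continuous_fderiv (by simp)).clm_apply continuous_const
    have hint : ∀ F : R3 → R3, AEStronglyMeasurable F (area M) →
        ∫⁻ y in B, ‖inner ℝ (F (P.ψ y)) (fderiv ℝ P.ψ y e)‖ₑ
          ≤ (P.K : ℝ≥0∞) * ‖e‖ₑ * ((P.K : ℝ≥0∞) ^ 2 * ∫⁻ x, ‖F x‖ₑ ∂area M) := by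
      intro F hF
      calc ∫⁻ y in B, ‖inner ℝ (F (P.ψ y)) (fderiv ℝ P.ψ y e)‖ₑ
          ≤ ∫⁻ y in B, (P.K : ℝ≥0∞) * ‖e‖ₑ * ‖F (P.ψ y)‖ₑ :=
            setLIntegral_mono' measurableSet_ball fun y hy => hbd _ y hy
        _ = (P.K : ℝ≥0∞) * ‖e‖ₑ * ∫⁻ y in B, ‖F (P.ψ y)‖ₑ :=
            lintegral_const_mul' _ _ (ENNReal.mul_ne_top ENNReal.coe_ne_top enorm_ne_top)
        _ ≤ _ := by
            gcongr
            exact P.lintegral_comp_le hF.enorm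
    have hgi : IntegrableOn (fun y => inner ℝ (G (P.ψ y)) (fderiv ℝ P.ψ y e)) B volume := by
      refine ⟨(hG.aestronglyMeasurable.comp_quasiMeasurePreserving P.quasiMeasurePreserving).inner
        hdψ.aestronglyMeasurable, (hint G hG.aestronglyMeasurable).trans_lt ?_⟩
      exact ENNReal.mul_lt_top (ENNReal.mul_lt_top ENNReal.coe_lt_top enorm_lt_top)
        (ENNReal.mul_lt_top (by simp) hG.hasFiniteIntegral)
    have h3 := ae_eq_zero_of_tendsto_fderiv (μ := volume) (B := B) Metric.isOpen_ball
      (f := fun n z => φ n (P.ψ z)) (v := e)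
      (fun n => ((hφ n).comp P.contDiff).of_le (by simp)) hgi ?_ ?_
    · rwa [ae_restrict_iff' measurableSet_ball]
    · have h4 := ENNReal.Tendsto.const_mul (a := (P.K : ℝ≥0∞) ^ 2) h0 (Or.inr (by simp))
      rw [mul_zero] at h4
      exact tendsto_of_tendsto_of_tendsto_of_le_of_le tendsto_const_nhds h4 (fun _ => bot_le)
        fun n => P.lintegral_comp_le (F := fun x => ‖φ n x‖ₑ)
          (hφ n).continuous.aestronglyMeasurable.enorm
    · have h4 := ENNReal.Tendsto.const_mul (a := (P.K : ℝ≥0∞) * ‖e‖ₑ * (P.K : ℝ≥0∞) ^ 2) h1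
        (Or.inr (ENNReal.mul_ne_top (ENNReal.mul_ne_top ENNReal.coe_ne_top enorm_ne_top) (by simp)))
      rw [mul_zero] at h4
      refine tendsto_of_tendsto_of_tendsto_of_le_of_le tendsto_const_nhds h4 (fun _ => bot_le)
        fun n => ?_
      refine le_trans (le_of_eq ?_)
        ((hint _ ((hgm n).sub hG.aestronglyMeasurable)).trans_eq (mul_assoc _ _ _).symm)
      refine setLIntegral_congr_fun measurableSet_ball fun y hy => ?_
      simp only [Pi.sub_apply, inner_sub_left, P.fderiv_comp_apply (hφ n) hy]
  refine ⟨{x | G x ≠ 0} ∩ P.O,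
    inter_mem self_mem_nhdsWithin (mem_nhdsWithin_of_mem_nhds (P.isOpen.mem_nhds hpO)), ?_⟩
  have hzero : ∀ᵐ y ∂volume.restrict B, G (P.ψ y) = 0 := by
    filter_upwards [hcomp (EuclideanSpace.single 0 1), hcomp (EuclideanSpace.single 1 1),
      P.quasiMeasurePreserving.ae hGT, ae_restrict_mem measurableSet_ball] with y h2 h3 h4 hy
    have h5 : ∀ w : R2, inner ℝ (G (P.ψ y)) (fderiv ℝ P.ψ y w) = 0 := by
      intro w
      have : w = w 0 • EuclideanSpace.single 0 1 + w 1 • EuclideanSpace.single 1 1 := by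
        ext i; fin_cases i <;> simp
      rw [this, map_add, map_smul, map_smul, inner_add_right, inner_smul_right, inner_smul_right,
        h2, h3]
      simp
    -- `G` is tangent, hence itself of the form `fderiv ψ w`; this choice of `w` yields `‖G‖ ^ 2 =
    -- 0`.
    have h6 := h5 (fderiv ℝ P.θ (P.ψ y) (G (P.ψ y)))
    rwa [P.fderiv_fderiv_inv hy h4, inner_self_eq_zero] at h6
  have h7 := P.ae_area (p := fun x => G x = 0) le_rfl hzero
  have h8 : area M Mᶜ = 0 := ae_mem_area hMc
  refine measure_mono_null (fun x hx => ?_) (measure_union_null h7 h8)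
  by_cases hxM : x ∈ M
  · exact Or.inl ⟨⟨⟨hxM, hx.2⟩, P.mapsTo_inv x ⟨hxM, hx.2⟩⟩, hx.1⟩
  · exact Or.inr hxM

/-- A function on a connected surface whose tangential gradient vanishes is constant. -/
theorem IsSmoothSurface.exists_ae_eq_const_of_tendsto_tangentialGrad {M : Set R3}
    (hM : IsSmoothSurface M) (hMc : IsCompact M) (hconn : IsConnected M)
    {φ : ℕ → R3 → ℝ} (hφ : ∀ n, ContDiff ℝ ∞ (φ n)) {V : R3 → ℝ}
    (hV : AEStronglyMeasurable V (area M))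
    (h0 : Tendsto (fun n => ∫⁻ x, ‖φ n x - V x‖ₑ ∂area M) atTop (𝓝 0))
    (h1 : Tendsto (fun n => ∫⁻ x, ‖tangentialGrad M (φ n) x‖ₑ ∂area M) atTop (𝓝 0)) :
    ∃ k : ℝ, ∀ᵐ x ∂area M, V x = k := by
  have hloc : ∀ p ∈ M, ∃ k : ℝ, ∃ s ∈ 𝓝[M] p, area M {x | x ∈ s ∧ ¬ V x = k} = 0 := by
    intro p hpM
    obtain ⟨P, hpO, hpc⟩ := hM.exists_localParametrization hpM
    have h2 := exists_ae_eq_const_of_tendsto_fderiv (μ := volume) (f := fun n z => φ n (P.ψ z))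
      (u := fun y => V (P.ψ y)) (c := P.c)
      (fun n => ((hφ n).comp P.contDiff).of_le (by simp)) P.r_pos
      (hV.comp_quasiMeasurePreserving P.quasiMeasurePreserving) ?_ ?_
    · obtain ⟨k, hk⟩ := h2
      refine ⟨k, _, P.nhdsWithin_mem ⟨hpM, hpO⟩ (ρ := P.r / 3) ?_,
        P.ae_area (p := fun x => V x = k) (by linarith [P.r_pos]) hk⟩
      rw [hpc]; exact Metric.mem_ball_self (by linarith [P.r_pos])
    · have h4 := ENNReal.Tendsto.const_mul (a := (P.K : ℝ≥0∞) ^ 2) h0 (Or.inr (by simp))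
      rw [mul_zero] at h4
      exact tendsto_of_tendsto_of_tendsto_of_le_of_le tendsto_const_nhds h4 (fun _ => bot_le)
        fun n => P.lintegral_comp_le (F := fun x => ‖φ n x - V x‖ₑ)
          ((hφ n).continuous.aestronglyMeasurable.sub hV).enorm
    · have h4 := ENNReal.Tendsto.const_mul (a := (P.K : ℝ≥0∞) * (P.K : ℝ≥0∞) ^ 2) h1
        (Or.inr (ENNReal.mul_ne_top ENNReal.coe_ne_top (by simp)))
      rw [mul_zero] at h4
      refine tendsto_of_tendsto_of_tendsto_of_le_of_le tendsto_const_nhds h4 (fun _ => bot_le)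
        fun n => ?_
      calc ∫⁻ y in Metric.ball P.c P.r, ‖fderiv ℝ (fun z => φ n (P.ψ z)) y‖ₑ
          ≤ ∫⁻ y in Metric.ball P.c P.r, (P.K : ℝ≥0∞) * ‖tangentialGrad M (φ n) (P.ψ y)‖ₑ := by
            refine setLIntegral_mono' measurableSet_ball fun y hy => ?_
            have h5 : ‖fderiv ℝ (fun z => φ n (P.ψ z)) y‖
                ≤ P.K * ‖tangentialGrad M (φ n) (P.ψ y)‖ := by
              refine ContinuousLinearMap.opNorm_le_bound _ (by positivity) fun e => ?_
              rw [P.fderiv_comp_apply (hφ n) hy]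
              refine (norm_inner_le_norm _ _).trans ?_
              have := ((fderiv ℝ P.ψ y).le_opNorm e).trans
                (mul_le_mul_of_nonneg_right (P.norm_fderiv_le hy) (norm_nonneg e))
              calc _ ≤ ‖tangentialGrad M (φ n) (P.ψ y)‖ * (P.K * ‖e‖) := by gcongr
                _ = _ := by ring
            have h6 := ENNReal.ofReal_le_ofReal h5
            rwa [ENNReal.ofReal_mul (by positivity), ofReal_norm, ofReal_norm,
              ENNReal.ofReal_coe_nnreal] at h6
        _ = (P.K : ℝ≥0∞) * ∫⁻ y in Metric.ball P.c P.r, ‖tangentialGrad M (φ n) (P.ψ y)‖ₑ :=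
            lintegral_const_mul' _ _ ENNReal.coe_ne_top
        _ ≤ _ := by
            rw [mul_assoc]
            gcongr
            exact P.lintegral_comp_le (hM.aestronglyMeasurable_tangentialGrad hMc (hφ n)).enorm
  choose! k s hs hk using hloc
  -- If the constants at `p` and a nearby `q` differed, the overlap of their neighbourhoods would be
  -- null, but relatively open pieces have positive area. So `k` is locally constant on the
  -- connected set `M`.
  have hconst : ∀ p ∈ M, ∀ᶠ q in 𝓝[M] p, k q = k p := by
    intro p hp
    filter_upwards [self_mem_nhdsWithin, eventually_mem_nhdsWithin_iff.2 (hs p hp)] with q hq hqs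
    by_contra hne
    refine hM.area_ne_zero_of_mem_nhdsWithin hq (inter_mem hqs (hs q hq)) ?_
    refine measure_mono_null (fun x hx => ?_) (measure_union_null (hk p hp) (hk q hq))
    by_cases hx2 : V x = k p
    · exact Or.inr ⟨hx.2, fun h => hne (h.symm.trans hx2)⟩
    · exact Or.inl ⟨hx.1, hx2⟩
  obtain ⟨p₀, hp₀⟩ := hconn.nonempty
  have hall : ∀ p ∈ M, k p = k p₀ := by
    intro p hp
    have : PreconnectedSpace M := isPreconnected_iff_preconnectedSpace.1 hconn.isPreconnected
    have hlc : IsLocallyConstant (fun p : M => k p) := by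
      rw [IsLocallyConstant.iff_eventually_eq]
      intro p
      rw [nhds_subtype_eq_comap_nhdsWithin]
      exact (hconst p p.2).comap _
    exact hlc.apply_eq_of_preconnectedSpace ⟨p, hp⟩ ⟨p₀, hp₀⟩
  refine ⟨k p₀, measure_null_of_locally_null _ fun p _ => ?_⟩
  by_cases hpM : p ∈ M
  swap
  · refine ⟨Mᶜ, mem_nhdsWithin_of_mem_nhds (hMc.isClosed.isOpen_compl.mem_nhds hpM), ?_⟩
    exact ae_mem_area hMc
  obtain ⟨U, hU, hUs⟩ := mem_nhdsWithin_iff_exists_mem_nhds_inter.1 (hs p hpM)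
  refine ⟨{x | ¬ V x = k p₀} ∩ U,
    inter_mem self_mem_nhdsWithin (mem_nhdsWithin_of_mem_nhds hU), ?_⟩
  have h8 : area M Mᶜ = 0 := ae_mem_area hMc
  refine measure_mono_null (fun x hx => ?_) (measure_union_null (hk p hpM) h8)
  by_cases hxM : x ∈ M
  · exact Or.inl ⟨hUs ⟨hx.2, hxM⟩, by rw [hall p hpM]; exact hx.1⟩
  · exact Or.inr hxM

end SurfaceObstacle

/-! ### The Sobolev space as a closed subspace of a Hilbert space of pairs. -/

noncomputable section

namespace SurfaceObstacle

/-- The smooth functions on `ℝ³`. -/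
def smoothFunctions : Submodule ℝ (R3 → ℝ) where
  carrier := {φ | ContDiff ℝ ∞ φ}
  add_mem' {φ ψ} (hφ : ContDiff ℝ ∞ φ) (hψ : ContDiff ℝ ∞ ψ) := hφ.add hψ
  zero_mem' := (contDiff_const : ContDiff ℝ ∞ fun _ : R3 => (0 : ℝ))
  smul_mem' c φ (hφ : ContDiff ℝ ∞ φ) := hφ.const_smul c

theorem contDiff_coe (φ : smoothFunctions) : ContDiff ℝ ∞ (φ : R3 → ℝ) := φ.2

theorem gradient_add {φ ψ : R3 → ℝ} (hφ : ContDiff ℝ ∞ φ) (hψ : ContDiff ℝ ∞ ψ) (x : R3) :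
    gradient (φ + ψ) x = gradient φ x + gradient ψ x := by
  simp only [gradient]
  rw [fderiv_add (hφ.differentiable (by simp) x) (hψ.differentiable (by simp) x), map_add]

theorem gradient_smul {φ : R3 → ℝ} (hφ : ContDiff ℝ ∞ φ) (c : ℝ) (x : R3) :
    gradient (c • φ) x = c • gradient φ x := by
  simp only [gradient]
  rw [fderiv_const_smul (hφ.differentiable (by simp) x), map_smulₛₗ]
  rfl

theorem tangentialGrad_comp {M : Set R3} {φ : R3 → ℝ} (hφ : ContDiff ℝ ∞ φ) {T : ℝ → ℝ}
    (hT : ContDiff ℝ ∞ T) (x : R3) :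
    tangentialGrad M (T ∘ φ) x = deriv T (φ x) • tangentialGrad M φ x := by
  have h : fderiv ℝ (T ∘ φ) x = deriv T (φ x) • fderiv ℝ φ x :=
    ((hT.differentiable (by simp) (φ x)).hasDerivAt.comp_hasFDerivAt x
      (hφ.differentiable (by simp) x).hasFDerivAt).fderiv
  rw [tangentialGrad, tangentialGrad, gradient, h, map_smulₛₗ, map_smul]
  rfl

theorem memLp_area_of_continuousOn {M : Set R3} (hM : IsSmoothSurface M) (hMc : IsCompact M)
    {F : Type*} [NormedAddCommGroup F] {f : R3 → F} (hf : ContinuousOn f M) :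
    MemLp f 2 (area M) := by
  have := hM.isFiniteMeasure_area hMc
  obtain ⟨C, hC⟩ := hMc.exists_bound_of_continuousOn hf
  refine MemLp.of_bound (hf.aestronglyMeasurable_of_isCompact hMc hMc.isClosed.measurableSet) C ?_
  filter_upwards [ae_mem_area hMc] with x hx using hC x hx

/-- Pairs of a square integrable function and a square integrable vector field on `M`. -/
abbrev L2Pair (M : Set R3) : Type :=
  WithLp 2 (Lp ℝ 2 (area M) × Lp R3 2 (area M))

section

variable {M : Set R3} (hM : IsSmoothSurface M) (hMc : IsCompact M)

/-- The pair of a smooth function and its tangential gradient. -/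
def jet : smoothFunctions →ₗ[ℝ] L2Pair M where
  toFun φ := WithLp.toLp 2
    ((memLp_area_of_continuousOn hM hMc (contDiff_coe φ).continuous.continuousOn).toLp φ,
      (memLp_area_of_continuousOn hM hMc (hM.continuousOn_tangentialGrad (contDiff_coe φ))).toLp
        (tangentialGrad M φ))
  map_add' φ ψ := by
    rw [← WithLp.toLp_add, Prod.mk_add_mk, ← MemLp.toLp_add, ← MemLp.toLp_add]
    congr 2
    refine MemLp.toLp_congr _ _ (Eventually.of_forall fun x => ?_)
    simp only [tangentialGrad, Pi.add_apply, ← map_add]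
    rw [← gradient_add (contDiff_coe φ) (contDiff_coe ψ)]
    rfl
  map_smul' c φ := by
    rw [RingHom.id_apply, ← WithLp.toLp_smul, Prod.smul_mk, ← MemLp.toLp_const_smul,
      ← MemLp.toLp_const_smul]
    congr 2
    refine MemLp.toLp_congr _ _ (Eventually.of_forall fun x => ?_)
    simp only [tangentialGrad, Pi.smul_apply, ← map_smul]
    rw [← gradient_smul (contDiff_coe φ)]
    rfl

theorem jet_fst (φ : smoothFunctions) : (jet hM hMc φ).fst =ᵐ[area M] (φ : R3 → ℝ) :=
  MemLp.coeFn_toLp (memLp_area_of_continuousOn hM hMc (contDiff_coe φ).continuous.continuousOn)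

theorem jet_snd (φ : smoothFunctions) :
    (jet hM hMc φ).snd =ᵐ[area M] tangentialGrad M φ :=
  MemLp.coeFn_toLp
    (memLp_area_of_continuousOn hM hMc (hM.continuousOn_tangentialGrad (contDiff_coe φ)))

/-- The Sobolev space `H¹(M)` as a closed subspace of `L²(M) × L²(M; ℝ³)`. -/
def sobolev : Submodule ℝ (L2Pair M) := (LinearMap.range (jet hM hMc)).topologicalClosure

theorem jet_mem_sobolev (φ : smoothFunctions) : jet hM hMc φ ∈ sobolev hM hMc :=
  Submodule.le_topologicalClosure _ ⟨φ, rfl⟩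

theorem isClosed_sobolev : IsClosed (sobolev hM hMc : Set (L2Pair M)) :=
  Submodule.isClosed_topologicalClosure _

theorem tendsto_l2Pair_iff {ι : Type*} {l : Filter ι} {u : ι → L2Pair M} {w : L2Pair M} :
    Tendsto u l (𝓝 w) ↔ Tendsto (fun i => (u i).fst) l (𝓝 w.fst) ∧
      Tendsto (fun i => (u i).snd) l (𝓝 w.snd) := by
  constructor
  · intro h
    exact ⟨((WithLp.continuous_fst 2 _ _).tendsto w).comp h,
      ((WithLp.continuous_snd 2 _ _).tendsto w).comp h⟩
  · rintro ⟨h1, h2⟩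
    exact ((WithLp.prod_continuous_toLp 2 _ _).tendsto (w.fst, w.snd)).comp (h1.prodMk_nhds h2)

theorem tendsto_jet_iff {φ : ℕ → smoothFunctions} {w : L2Pair M} :
    Tendsto (fun n => jet hM hMc (φ n)) atTop (𝓝 w) ↔
      Tendsto (fun n => eLpNorm (fun x => (φ n : R3 → ℝ) x - w.fst x) 2 (area M)) atTop (𝓝 0) ∧
      Tendsto (fun n => eLpNorm (fun x => tangentialGrad M (φ n) x - w.snd x) 2 (area M))
        atTop (𝓝 0) := by
  rw [tendsto_l2Pair_iff, Lp.tendsto_Lp_iff_tendsto_eLpNorm', Lp.tendsto_Lp_iff_tendsto_eLpNorm']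
  refine and_congr (tendsto_congr fun n => eLpNorm_congr_ae ?_)
    (tendsto_congr fun n => eLpNorm_congr_ae ?_)
  · filter_upwards [jet_fst hM hMc (φ n)] with x hx
    rw [Pi.sub_apply, hx]
  · filter_upwards [jet_snd hM hMc (φ n)] with x hx
    rw [Pi.sub_apply, hx]

theorem mem_sobolev_iff {w : L2Pair M} : w ∈ sobolev hM hMc ↔
    ∃ φ : ℕ → smoothFunctions, Tendsto (fun n => jet hM hMc (φ n)) atTop (𝓝 w) := by
  rw [← SetLike.mem_coe, sobolev, Submodule.topologicalClosure_coe, mem_closure_iff_seq_limit]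
  constructor
  · rintro ⟨u, hu, h⟩
    choose φ hφ using hu
    exact ⟨φ, by simpa only [hφ] using h⟩
  · rintro ⟨φ, h⟩
    exact ⟨_, fun n => ⟨φ n, rfl⟩, h⟩

theorem hasWeakGradient_of_mem_sobolev {w : L2Pair M} (hw : w ∈ sobolev hM hMc) :
    HasWeakGradient M w.fst w.snd := by
  obtain ⟨φ, h⟩ := (mem_sobolev_iff hM hMc).1 hw
  rw [tendsto_jet_iff] at h
  exact ⟨Lp.memLp _, Lp.memLp _, fun n => φ n, fun n => (φ n).2, h.1, h.2⟩

theorem memH1_of_mem_sobolev {w : L2Pair M} (hw : w ∈ sobolev hM hMc) : MemH1 M w.fst :=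
  ⟨_, hasWeakGradient_of_mem_sobolev hM hMc hw⟩

theorem HasWeakGradient.exists_mem_sobolev {V : R3 → ℝ} {G : R3 → R3}
    (h : HasWeakGradient M V G) :
    ∃ w ∈ sobolev hM hMc, w.fst =ᵐ[area M] V ∧ w.snd =ᵐ[area M] G := by
  obtain ⟨hV, hG, φ, hφ, h1, h2⟩ := h
  refine ⟨WithLp.toLp 2 (hV.toLp V, hG.toLp G), ?_, hV.coeFn_toLp, hG.coeFn_toLp⟩
  rw [mem_sobolev_iff]
  refine ⟨fun n => ⟨φ n, hφ n⟩, ?_⟩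
  rw [tendsto_jet_iff]
  refine ⟨h1.congr fun n => eLpNorm_congr_ae ?_, h2.congr fun n => eLpNorm_congr_ae ?_⟩
  · filter_upwards [hV.coeFn_toLp] with x hx
    rw [WithLp.toLp_fst, hx]
  · filter_upwards [hG.coeFn_toLp] with x hx
    rw [WithLp.toLp_snd, hx]

theorem tendsto_lintegral_enorm_of_tendsto_eLpNorm {α F : Type*} [MeasurableSpace α]
    [NormedAddCommGroup F] {μ : Measure α} [IsFiniteMeasure μ] {f : ℕ → α → F}
    (hf : ∀ n, AEStronglyMeasurable (f n) μ)
    (h : Tendsto (fun n => eLpNorm (f n) 2 μ) atTop (𝓝 0)) :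
    Tendsto (fun n => ∫⁻ x, ‖f n x‖ₑ ∂μ) atTop (𝓝 0) := by
  have h1 := ENNReal.Tendsto.mul_const (b := μ Set.univ ^ (1 / (1 : ℝ≥0∞).toReal - 1 / (2 : ℝ≥0∞).toReal)) h
    (Or.inr (by
      refine ENNReal.rpow_ne_top_of_nonneg ?_ (measure_ne_top _ _)
      norm_num))
  rw [zero_mul] at h1
  refine tendsto_of_tendsto_of_tendsto_of_le_of_le tendsto_const_nhds h1 (fun _ => bot_le)
    fun n => ?_
  have h2 := eLpNorm_le_eLpNorm_mul_rpow_measure_univ (p := 1) (q := 2) (by norm_num) (hf n)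
  rwa [eLpNorm_one_eq_lintegral_enorm] at h2

/-- Closability in Hilbert space form: a function determines its gradient, which makes the choice in
`weakGrad` immaterial. -/
theorem snd_eq_zero_of_mem_sobolev {w : L2Pair M} (hw : w ∈ sobolev hM hMc) (h0 : w.fst = 0) :
    w.snd = 0 := by
  have := hM.isFiniteMeasure_area hMc
  obtain ⟨φ, h⟩ := (mem_sobolev_iff hM hMc).1 hw
  rw [tendsto_jet_iff] at h
  have h1 := tendsto_lintegral_enorm_of_tendsto_eLpNorm (fun n =>
    (contDiff_coe (φ n)).continuous.aestronglyMeasurable.sub (Lp.aestronglyMeasurable w.fst)) h.1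
  have h2 := tendsto_lintegral_enorm_of_tendsto_eLpNorm (fun n =>
    (hM.aestronglyMeasurable_tangentialGrad hMc (φ n).2).sub (Lp.aestronglyMeasurable w.snd)) h.2
  have h3 := hM.ae_eq_zero_of_tendsto_tangentialGrad hMc (φ := fun n => φ n) (fun n => (φ n).2)
    ((Lp.memLp w.snd).integrable (by norm_num)) (h1.congr fun n => lintegral_congr_ae ?_) h2
  · rw [Lp.eq_zero_iff_ae_eq_zero]
    exact h3
  · filter_upwards [Lp.eq_zero_iff_ae_eq_zero.1 h0] with x hx
    simp only [Pi.sub_apply, hx, Pi.zero_apply, sub_zero]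

theorem exists_ae_eq_const_of_mem_sobolev (hconn : IsConnected M) {w : L2Pair M}
    (hw : w ∈ sobolev hM hMc) (h0 : w.snd = 0) : ∃ k : ℝ, ∀ᵐ x ∂area M, w.fst x = k := by
  have := hM.isFiniteMeasure_area hMc
  obtain ⟨φ, h⟩ := (mem_sobolev_iff hM hMc).1 hw
  rw [tendsto_jet_iff] at h
  have h1 := tendsto_lintegral_enorm_of_tendsto_eLpNorm (fun n =>
    (contDiff_coe (φ n)).continuous.aestronglyMeasurable.sub (Lp.aestronglyMeasurable w.fst)) h.1
  have h2 := tendsto_lintegral_enorm_of_tendsto_eLpNorm (fun n =>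
    (hM.aestronglyMeasurable_tangentialGrad hMc (φ n).2).sub (Lp.aestronglyMeasurable w.snd)) h.2
  refine hM.exists_ae_eq_const_of_tendsto_tangentialGrad hMc hconn (φ := fun n => φ n)
    (fun n => (φ n).2) (Lp.aestronglyMeasurable w.fst) h1
    (h2.congr fun n => lintegral_congr_ae ?_)
  filter_upwards [Lp.eq_zero_iff_ae_eq_zero.1 h0] with x hx
  simp only [Pi.sub_apply, hx, Pi.zero_apply, sub_zero]

/-- The chosen weak gradient agrees with every weak gradient. -/
theorem weakGrad_ae_eq {V : R3 → ℝ} {w : L2Pair M} (hw : w ∈ sobolev hM hMc)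
    (hV : w.fst =ᵐ[area M] V) : weakGrad M V =ᵐ[area M] w.snd := by
  have hH1 : MemH1 M V := by
    obtain ⟨h1, h2, φ, h3, h4, h5⟩ := hasWeakGradient_of_mem_sobolev hM hMc hw
    refine ⟨w.snd, h1.ae_eq hV, h2, φ, h3, h4.congr fun n => eLpNorm_congr_ae ?_, h5⟩
    filter_upwards [hV] with x hx
    rw [hx]
  rw [weakGrad, dif_pos hH1]
  obtain ⟨z, hz, hz1, hz2⟩ := hH1.choose_spec.exists_mem_sobolev hM hMc
  have h1 : (z - w).fst = 0 := by
    rw [WithLp.sub_fst, sub_eq_zero]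
    exact Lp.ext (hz1.trans hV.symm)
  have h2 := snd_eq_zero_of_mem_sobolev hM hMc (Submodule.sub_mem _ hz hw) h1
  rw [WithLp.sub_snd, sub_eq_zero] at h2
  rw [← h2]
  exact hz2.symm

end

/-- Dominated convergence with majorant `‖g‖ ^ 2`. It serves for the error `(T' - 1) ∇w` created by
truncation. -/
theorem tendsto_eLpNorm_smul_of_tendsto_zero {α F : Type*} [MeasurableSpace α]
    [NormedAddCommGroup F] [NormedSpace ℝ F] {μ : Measure α} {c : ℕ → α → ℝ} {g : α → F}
    (hc : ∀ n, AEStronglyMeasurable (c n) μ) (hg : MemLp g 2 μ)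
    (hc1 : ∀ n x, ‖c n x‖ ≤ 1) (hlim : ∀ᵐ x ∂μ, Tendsto (fun n => c n x) atTop (𝓝 0)) :
    Tendsto (fun n => eLpNorm (fun x => c n x • g x) 2 μ) atTop (𝓝 0) := by
  have hfin := lintegral_rpow_enorm_lt_top_of_eLpNorm_lt_top (by norm_num) (by norm_num) hg.2
  have h1 : Tendsto (fun n => ∫⁻ x, ‖c n x • g x‖ₑ ^ (2 : ℝ≥0∞).toReal ∂μ) atTop
      (𝓝 (∫⁻ _, 0 ∂μ)) := by
    refine tendsto_lintegral_of_dominated_convergence' (fun x => ‖g x‖ₑ ^ (2 : ℝ≥0∞).toReal)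
      (fun n => ((hc n).smul hg.1).enorm.pow_const _)
      (fun n => Eventually.of_forall fun x => ?_) hfin.ne ?_
    · dsimp only
      gcongr
      rw [enorm_le_iff_norm_le, norm_smul]
      exact mul_le_of_le_one_left (norm_nonneg _) (hc1 n x)
    · filter_upwards [hlim] with x hx
      have h2 : Tendsto (fun n => ‖c n x • g x‖ₑ) atTop (𝓝 0) := by
        have := (hx.smul_const (g x)).enorm
        simpa using this
      have h3 := (ENNReal.continuous_rpow_const (y := (2 : ℝ≥0∞).toReal)).tendsto 0
      rw [ENNReal.zero_rpow_of_pos (by norm_num)] at h3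
      exact h3.comp h2
  rw [lintegral_zero] at h1
  have h3 := (ENNReal.continuous_rpow_const (y := 1 / (2 : ℝ≥0∞).toReal)).tendsto 0
  rw [ENNReal.zero_rpow_of_pos (by norm_num)] at h3
  refine (h3.comp h1).congr fun n => ?_
  rw [Function.comp_apply, eLpNorm_eq_lintegral_rpow_enorm_toReal (by norm_num) (by norm_num)]

/-- An element of `H¹(M)` with values in `[a, b]` is a limit of smooth functions with values
in `[a - ε, b + ε]`. -/
theorem exists_tendsto_jet_of_bounds {M : Set R3} (hM : IsSmoothSurface M) (hMc : IsCompact M)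
    {w : L2Pair M} (hw : w ∈ sobolev hM hMc) {a b ε : ℝ} (hab : a < b) (hε : 0 < ε)
    (hwab : ∀ᵐ x ∂area M, a ≤ w.fst x ∧ w.fst x ≤ b) :
    ∃ φ : ℕ → smoothFunctions, (∀ n x, a - ε ≤ (φ n : R3 → ℝ) x ∧ (φ n : R3 → ℝ) x ≤ b + ε) ∧
      Tendsto (fun n => jet hM hMc (φ n)) atTop (𝓝 w) := by
  obtain ⟨T, hT, hTr, hT1, hTid, hTd⟩ := exists_smooth_truncation hab hε
  obtain ⟨φ₀, hφ₀⟩ := (mem_sobolev_iff hM hMc).1 hw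
  -- A subsequence converges almost everywhere, so that the factors `deriv T (φ n)` converge
  -- pointwise.
  obtain ⟨ns, hns, hae⟩ :=
    (tendstoInMeasure_of_tendsto_Lp (tendsto_l2Pair_iff.1 hφ₀).1).exists_seq_tendsto_ae
  have hφ := (tendsto_jet_iff hM hMc).1 (hφ₀.comp hns.tendsto_atTop)
  set φ : ℕ → smoothFunctions := fun n => φ₀ (ns n) with hφdef
  have hae' : ∀ᵐ x ∂area M, Tendsto (fun n => (φ n : R3 → ℝ) x) atTop (𝓝 (w.fst x)) := by
    have h1 : ∀ᵐ x ∂area M, ∀ n, (jet hM hMc (φ n)).fst x = (φ n : R3 → ℝ) x :=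
      ae_all_iff.2 fun n => jet_fst hM hMc (φ n)
    filter_upwards [hae, h1] with x hx h2
    exact hx.congr h2
  have hφc : ∀ n, ContDiff ℝ ∞ (φ n : R3 → ℝ) := fun n => (φ n).2
  have hdT : Continuous (deriv T) := hT.continuous_deriv (by simp)
  have hlip : ∀ s t, |T s - T t| ≤ |s - t| := by
    have h1 : LipschitzWith 1 T := lipschitzWith_of_nnnorm_deriv_le
      (hT.differentiable (by simp)) fun x => by
        rw [← NNReal.coe_le_coe, coe_nnnorm, Real.norm_of_nonneg (hT1 x).1]
        exact (hT1 x).2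
    intro s t
    simpa [Real.dist_eq] using h1.dist_le_mul s t
  refine ⟨fun n => ⟨T ∘ φ n, hT.comp (hφc n)⟩, fun n x => hTr _, ?_⟩
  rw [tendsto_jet_iff]
  constructor
  · refine tendsto_of_tendsto_of_tendsto_of_le_of_le tendsto_const_nhds hφ.1 (fun _ => bot_le)
      fun n => eLpNorm_mono_ae ?_
    filter_upwards [hwab] with x hx
    have := hlip ((φ n : R3 → ℝ) x) (w.fst x)
    rwa [hTid _ hx] at this
  -- The error is `T'(φ n) (∇φ n - ∇w) + (T'(φ n) - 1) ∇w`. The first term is controlled by `T' ≤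
  -- 1`; in the second, `T'(φ n)` tends to `1` because `w` takes values in `[a, b]`.
  · have h1 := tendsto_eLpNorm_smul_of_tendsto_zero (μ := area M)
      (c := fun n x => deriv T ((φ n : R3 → ℝ) x) - 1)
      (fun n => ((hdT.comp (hφc n).continuous).sub continuous_const).aestronglyMeasurable)
      (Lp.memLp w.snd)
      (fun n x => by
        rw [Real.norm_eq_abs, abs_le]
        constructor <;> linarith [(hT1 ((φ n : R3 → ℝ) x)).1, (hT1 ((φ n : R3 → ℝ) x)).2]) (by
        filter_upwards [hae', hwab] with x hx hab
        have := ((hdT.tendsto _).comp hx).sub_const 1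
        rw [hTd _ hab, sub_self] at this
        exact this)
    have h2 := hφ.2.add h1
    rw [add_zero] at h2
    refine tendsto_of_tendsto_of_tendsto_of_le_of_le tendsto_const_nhds h2 (fun _ => bot_le)
      fun n => ?_
    have hgm := hM.aestronglyMeasurable_tangentialGrad hMc (hφc n)
    have hwm := Lp.aestronglyMeasurable w.snd
    have hdm : AEStronglyMeasurable (fun x => deriv T ((φ n : R3 → ℝ) x)) (area M) :=
      (hdT.comp (hφc n).continuous).aestronglyMeasurable
    calc eLpNorm (fun x => tangentialGrad M (T ∘ φ n) x - w.snd x) 2 (area M)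
        = eLpNorm ((fun x => deriv T ((φ n : R3 → ℝ) x) • (tangentialGrad M (φ n) x - w.snd x))
            + fun x => (deriv T ((φ n : R3 → ℝ) x) - 1) • w.snd x) 2 (area M) := by
          congr 1
          ext1 x
          rw [tangentialGrad_comp (hφc n) hT, Pi.add_apply, smul_sub, sub_smul, one_smul]
          abel
      _ ≤ eLpNorm (fun x => deriv T ((φ n : R3 → ℝ) x) • (tangentialGrad M (φ n) x - w.snd x))
            2 (area M) + eLpNorm (fun x => (deriv T ((φ n : R3 → ℝ) x) - 1) • w.snd x) 2 (area M) :=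
          eLpNorm_add_le (hdm.smul (hgm.sub hwm))
            ((hdm.sub aestronglyMeasurable_const).smul hwm) (by norm_num)
      _ ≤ _ := by
          gcongr
          refine eLpNorm_mono fun x => ?_
          rw [norm_smul, Real.norm_of_nonneg (hT1 _).1]
          exact mul_le_of_le_one_left (norm_nonneg _) (hT1 _).2

/-- The nonzero measure provides a point between the essential bounds, excluding the supremum `⊥`
and the infimum `⊤`; any other infinite bound makes the difference `⊤`. -/
theorem essOsc_le_iff {M : Set R3} (hne : (ae (area M)).NeBot) {V : R3 → ℝ} {β : ℝ} :
    essOsc M V ≤ (β : EReal) ↔ ∃ a : ℝ, ∀ᵐ x ∂area M, a ≤ V x ∧ V x ≤ a + β := by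
  constructor
  · intro h
    rw [essOsc] at h
    have h1 : ∀ᵐ x ∂area M, (V x : EReal) ≤ essSup (fun x => (V x : EReal)) (area M) :=
      _root_.ae_le_essSup
    have h2 : ∀ᵐ x ∂area M, essInf (fun x => (V x : EReal)) (area M) ≤ (V x : EReal) :=
      _root_.ae_essInf_le
    generalize essSup (fun x => (V x : EReal)) (area M) = S at h h1
    generalize essInf (fun x => (V x : EReal)) (area M) = I at h h2
    obtain ⟨x, hx1, hx2⟩ := (h1.and h2).exists
    induction S with
    | bot => exact absurd hx1 (by simp)
    | top =>
      induction I with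
      | bot => exact absurd h (by simp)
      | top => exact absurd hx2 (by simp)
      | coe i => exact absurd h (by simp)
    | coe s =>
      induction I with
      | bot => exact absurd h (by simp)
      | top => exact absurd hx2 (by simp)
      | coe i =>
        rw [← EReal.coe_sub, EReal.coe_le_coe_iff] at h
        refine ⟨i, ?_⟩
        filter_upwards [h1, h2] with y hy1 hy2
        rw [EReal.coe_le_coe_iff] at hy1 hy2
        exact ⟨hy2, by linarith⟩
  · rintro ⟨a, ha⟩
    have h1 : essSup (fun x => (V x : EReal)) (area M) ≤ ((a + β : ℝ) : EReal) :=
      essSup_le_of_ae_le _ (by filter_upwards [ha] with x hx using EReal.coe_le_coe_iff.2 hx.2)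
    have h2 : (a : EReal) ≤ essInf (fun x => (V x : EReal)) (area M) :=
      le_essInf_of_ae_le _ (by filter_upwards [ha] with x hx using EReal.coe_le_coe_iff.2 hx.1)
    rw [essOsc]
    refine (EReal.sub_le_sub h1 h2).trans ?_
    rw [← EReal.coe_sub, EReal.coe_le_coe_iff]
    linarith

end SurfaceObstacle
end

/-! ### The obstacle problem: first variation, invariance under constants, existence. -/

noncomputable section

namespace SurfaceObstacle

section

variable {M : Set R3} (h : Lp ℝ 2 (area M))

/-- The pairing of the distribution `-Δw + h` with `z`. -/
def pairing (w z : L2Pair M) : ℝ := inner ℝ w.snd z.snd + inner ℝ h z.fst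

/-- The obstacle functional on pairs of a function and its gradient. -/
def pairEnergy (w : L2Pair M) : ℝ := ‖w.snd‖ ^ 2 + 2 * inner ℝ h w.fst

theorem pairing_self (w : L2Pair M) : pairing h w w = ‖w.snd‖ ^ 2 + inner ℝ h w.fst := by
  rw [pairing, real_inner_self_eq_norm_sq]

theorem pairing_sub_right (w z z' : L2Pair M) :
    pairing h w (z - z') = pairing h w z - pairing h w z' := by
  simp only [pairing, WithLp.sub_fst, WithLp.sub_snd, inner_sub_right]; ring

theorem pairing_smul_right (w z : L2Pair M) (c : ℝ) :
    pairing h w (c • z) = c * pairing h w z := by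
  simp only [pairing, WithLp.smul_fst, WithLp.smul_snd, inner_smul_right]; ring

theorem continuous_fst_l2Pair : Continuous fun w : L2Pair M => w.fst :=
  WithLp.continuous_fst 2 _ _

theorem continuous_snd_l2Pair : Continuous fun w : L2Pair M => w.snd :=
  WithLp.continuous_snd 2 _ _

theorem continuous_pairing (w : L2Pair M) : Continuous (pairing h w) :=
  (continuous_const.inner continuous_snd_l2Pair).add (continuous_const.inner continuous_fst_l2Pair)

theorem continuous_pairEnergy : Continuous (pairEnergy h) :=
  (continuous_snd_l2Pair.norm.pow 2).add
    (continuous_const.mul (continuous_const.inner continuous_fst_l2Pair))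

theorem convexOn_pairEnergy : ConvexOn ℝ Set.univ (pairEnergy h) := by
  refine ⟨convex_univ, fun w _ z _ a b ha hb hab => ?_⟩
  have h1 : ‖a • w.snd + b • z.snd‖ ^ 2 ≤ a * ‖w.snd‖ ^ 2 + b * ‖z.snd‖ ^ 2 := by
    have h2 := norm_add_le (a • w.snd) (b • z.snd)
    rw [norm_smul, norm_smul, Real.norm_of_nonneg ha, Real.norm_of_nonneg hb] at h2
    have h3 : ‖a • w.snd + b • z.snd‖ ^ 2 ≤ (a * ‖w.snd‖ + b * ‖z.snd‖) ^ 2 := by gcongr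
    have h4 : b = 1 - a := by linarith
    subst h4
    nlinarith [mul_nonneg (mul_nonneg ha hb) (sq_nonneg (‖w.snd‖ - ‖z.snd‖))]
  simp only [pairEnergy, WithLp.add_fst, WithLp.add_snd, WithLp.smul_fst, WithLp.smul_snd,
    inner_add_right, inner_smul_right, smul_eq_mul]
  linarith

/-- The first variation inequality for a minimizer over a convex set. -/
theorem pairing_self_le_of_isMin {C : Set (L2Pair M)} (hC : Convex ℝ C) {w z : L2Pair M}
    (hw : w ∈ C) (hz : z ∈ C) (hmin : ∀ z ∈ C, pairEnergy h w ≤ pairEnergy h z) :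
    pairing h w w ≤ pairing h w z := by
  -- The energy is quadratic along the segment from `w` to `z`; its increment is divided by `t`.
  have h1 : ∀ t : ℝ, 0 < t → t ≤ 1 →
      0 ≤ 2 * (pairing h w z - pairing h w w) + t * ‖(z - w).snd‖ ^ 2 := by
    intro t ht ht1
    have h2 := hmin _ (hC.add_smul_sub_mem hw hz ⟨ht.le, ht1⟩)
    have h3 : pairEnergy h (w + t • (z - w)) = pairEnergy h w
        + t * (2 * (pairing h w z - pairing h w w) + t * ‖(z - w).snd‖ ^ 2) := by
      rw [← pairing_sub_right]
      simp only [pairEnergy, pairing, WithLp.add_fst, WithLp.add_snd, WithLp.smul_fst,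
        WithLp.smul_snd, inner_add_right, inner_smul_right]
      rw [norm_add_sq_real, inner_smul_right, norm_smul, mul_pow, Real.norm_eq_abs, sq_abs]
      ring
    rw [h3] at h2
    exact nonneg_of_mul_nonneg_right (by linarith) ht
  by_contra hlt
  rw [not_le] at hlt
  set d := pairing h w w - pairing h w z with hd
  have hd0 : 0 < d := by linarith
  set q := ‖(z - w).snd‖ ^ 2 with hq
  have hq0 : 0 ≤ q := by positivity
  -- With this `t` the quadratic term is at most `d`, too small to offset the linear term `-2 * d`.
  have ht0 : 0 < min 1 (d / (q + 1)) := lt_min one_pos (by positivity)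
  have h4 := h1 _ ht0 (min_le_left _ _)
  have h5 : min 1 (d / (q + 1)) * q ≤ d / (q + 1) * q :=
    mul_le_mul_of_nonneg_right (min_le_right _ _) hq0
  have h6 : d / (q + 1) * q ≤ d := by
    rw [div_mul_eq_mul_div, div_le_iff₀ (by positivity)]
    nlinarith
  linarith

end

section

variable {M : Set R3} (hM : IsSmoothSurface M) (hMc : IsCompact M)

/-- The admissible class, as a set of pairs of a function and its gradient. -/
def admissiblePairs (β : ℝ) : Set (L2Pair M) :=
  {w | w ∈ sobolev hM hMc ∧ ∃ a : ℝ, ∀ᵐ x ∂area M, a ≤ w.fst x ∧ w.fst x ≤ a + β}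

theorem convex_admissiblePairs (β : ℝ) : Convex ℝ (admissiblePairs hM hMc β) := by
  rintro w ⟨hw, a, ha⟩ z ⟨hz, b, hb⟩ s t hs ht hst
  refine ⟨(sobolev hM hMc).convex hw hz hs ht hst, s * a + t * b, ?_⟩
  filter_upwards [ha, hb, Lp.coeFn_add (s • w.fst) (t • z.fst), Lp.coeFn_smul s w.fst,
    Lp.coeFn_smul t z.fst] with x h1 h2 h3 h4 h5
  rw [WithLp.add_fst, WithLp.smul_fst, WithLp.smul_fst, h3, Pi.add_apply, h4, h5]
  simp only [Pi.smul_apply, smul_eq_mul]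
  have h6 : β = s * β + t * β := by rw [← add_mul, hst, one_mul]
  constructor
  · nlinarith [mul_le_mul_of_nonneg_left h1.1 hs, mul_le_mul_of_nonneg_left h2.1 ht]
  · nlinarith [mul_le_mul_of_nonneg_left h1.2 hs, mul_le_mul_of_nonneg_left h2.2 ht]

/-- The constant function `k`, with its gradient. -/
def constPair (k : ℝ) : L2Pair M := jet hM hMc ⟨fun _ => k, (contDiff_const : ContDiff ℝ ∞ _)⟩

theorem constPair_fst (k : ℝ) : (constPair hM hMc k).fst =ᵐ[area M] fun _ => k :=
  jet_fst hM hMc _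

theorem constPair_snd (k : ℝ) : (constPair hM hMc k).snd = 0 := by
  rw [Lp.eq_zero_iff_ae_eq_zero]
  refine (jet_snd hM hMc _).trans (Eventually.of_forall fun x => ?_)
  simp [tangentialGrad]

theorem constPair_mem (k : ℝ) : constPair hM hMc k ∈ sobolev hM hMc := jet_mem_sobolev hM hMc _

/-- The mean-zero condition on `H` enters here: it makes the energy, and the pairing in its second
argument, blind to added constants. -/
theorem inner_constPair {h : Lp ℝ 2 (area M)} (hh : ∫ x, h x ∂area M = 0) (k : ℝ) :
    inner ℝ h (constPair hM hMc k).fst = 0 := by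
  rw [L2.inner_def, integral_congr_ae (g := fun x => k * h x), integral_const_mul, hh, mul_zero]
  filter_upwards [constPair_fst hM hMc k] with x hx
  rw [hx]
  simp

theorem pairEnergy_add_constPair {h : Lp ℝ 2 (area M)} (hh : ∫ x, h x ∂area M = 0) (k : ℝ)
    (w : L2Pair M) : pairEnergy h (w + constPair hM hMc k) = pairEnergy h w := by
  simp only [pairEnergy, WithLp.add_fst, WithLp.add_snd, constPair_snd, add_zero, inner_add_right,
    inner_constPair hM hMc hh]

theorem add_constPair_mem_admissiblePairs {β : ℝ} {w : L2Pair M}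
    (hw : w ∈ admissiblePairs hM hMc β) (k : ℝ) :
    w + constPair hM hMc k ∈ admissiblePairs hM hMc β := by
  obtain ⟨hw, a, ha⟩ := hw
  refine ⟨Submodule.add_mem _ hw (constPair_mem hM hMc k), a + k, ?_⟩
  filter_upwards [ha, constPair_fst hM hMc k, Lp.coeFn_add w.fst (constPair hM hMc k).fst]
    with x h1 h2 h3
  rw [WithLp.add_fst, h3, Pi.add_apply, h2]
  constructor <;> linarith [h1.1, h1.2]

theorem zero_mem_admissiblePairs {β : ℝ} (hβ : 0 ≤ β) : (0 : L2Pair M) ∈ admissiblePairs hM hMc β := by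
  refine ⟨Submodule.zero_mem _, 0, ?_⟩
  rw [WithLp.zero_fst]
  filter_upwards [Lp.coeFn_zero ℝ 2 (area M)] with x hx
  rw [hx]
  simpa using hβ

/-- The obstacle problem has a solution. -/
theorem exists_isMin_pairEnergy {h : Lp ℝ 2 (area M)} (hh : ∫ x, h x ∂area M = 0) {β : ℝ}
    (hβ : 0 ≤ β) : ∃ w ∈ admissiblePairs hM hMc β, ∀ z ∈ admissiblePairs hM hMc β,
      pairEnergy h w ≤ pairEnergy h z := by
  have := hM.isFiniteMeasure_area hMc
  let u : Lp ℝ 2 (area M) := (constPair hM hMc β).fst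
  have hu : u =ᵐ[area M] fun _ => β := constPair_fst hM hMc β
  -- Subtracting a constant normalizes competitors to values in `[0, β]`. This removes the unbounded
  -- direction of the admissible class without changing the energy.
  let K : Set (L2Pair M) := {w | w ∈ sobolev hM hMc ∧ w.fst ∈ Set.Icc 0 u}
  have hKcl : IsClosed K :=
    (isClosed_sobolev hM hMc).inter (isClosed_Icc.preimage continuous_fst_l2Pair)
  have hKiff : ∀ w : L2Pair M, w.fst ∈ Set.Icc 0 u ↔
      ∀ᵐ x ∂area M, 0 ≤ w.fst x ∧ w.fst x ≤ β := by
    intro w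
    rw [Set.mem_Icc, ← Lp.coeFn_nonneg, ← Lp.coeFn_le, eventually_and]
    refine and_congr Iff.rfl ⟨fun h => ?_, fun h => ?_⟩
    · filter_upwards [h, hu] with x h1 h2
      rwa [h2] at h1
    · filter_upwards [h, hu] with x h1 h2
      rwa [h2]
  have hKcv : Convex ℝ K := by
    rintro w ⟨hw, ha⟩ z ⟨hz, hb⟩ s t hs ht hst
    refine ⟨(sobolev hM hMc).convex hw hz hs ht hst, ?_⟩
    rw [hKiff] at ha hb ⊢
    filter_upwards [ha, hb, Lp.coeFn_add (s • w.fst) (t • z.fst), Lp.coeFn_smul s w.fst,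
      Lp.coeFn_smul t z.fst] with x h1 h2 h3 h4 h5
    rw [WithLp.add_fst, WithLp.smul_fst, WithLp.smul_fst, h3, Pi.add_apply, h4, h5]
    exact convex_Icc 0 β h1 h2 hs ht hst
  have hKsub : K ⊆ admissiblePairs hM hMc β := fun w hw =>
    ⟨hw.1, 0, by simpa only [zero_add] using (hKiff w).1 hw.2⟩
  have hKred : ∀ z ∈ admissiblePairs hM hMc β, ∃ w ∈ K, pairEnergy h w = pairEnergy h z := by
    rintro z ⟨hz, a, ha⟩
    refine ⟨z + constPair hM hMc (-a),
      ⟨Submodule.add_mem _ hz (constPair_mem hM hMc _), (hKiff _).2 ?_⟩,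
      pairEnergy_add_constPair hM hMc hh _ _⟩
    filter_upwards [ha, constPair_fst hM hMc (-a), Lp.coeFn_add z.fst (constPair hM hMc (-a)).fst]
      with x h1 h2 h3
    rw [WithLp.add_fst, h3, Pi.add_apply, h2]
    constructor <;> linarith [h1.1, h1.2]
  have hK0 : (0 : L2Pair M) ∈ K := ⟨Submodule.zero_mem _, (hKiff 0).2 (by
    rw [WithLp.zero_fst]
    filter_upwards [Lp.coeFn_zero ℝ 2 (area M)] with x hx
    rw [hx]
    simpa using hβ)⟩
  have hfst : ∀ w ∈ K, ‖w.fst‖ ≤ ‖u‖ := by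
    intro w hw
    refine Lp.norm_le_norm_of_ae_le ?_
    filter_upwards [(hKiff w).1 hw.2, hu] with x h1 h2
    rw [h2, Real.norm_of_nonneg h1.1, Real.norm_of_nonneg hβ]
    exact h1.2
  have hin : ∀ w ∈ K, -(‖h‖ * ‖u‖) ≤ inner ℝ h w.fst := by
    intro w hw
    have h1 := abs_real_inner_le_norm h w.fst
    have h2 : ‖h‖ * ‖w.fst‖ ≤ ‖h‖ * ‖u‖ := mul_le_mul_of_nonneg_left (hfst w hw) (norm_nonneg _)
    linarith [neg_abs_le (inner ℝ h w.fst)]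
  have hlow : ∀ w ∈ K, -(2 * (‖h‖ * ‖u‖)) ≤ pairEnergy h w := by
    intro w hw
    have := hin w hw
    rw [pairEnergy]
    nlinarith [sq_nonneg ‖w.snd‖]
  set m := sInf (pairEnergy h '' K) with hm
  have hbdd : BddBelow (pairEnergy h '' K) := ⟨_, by rintro _ ⟨w, hw, rfl⟩; exact hlow w hw⟩
  -- Sublevel sets near the infimum are nested, closed and convex. Boundedness of `S 0` comes from
  -- `‖w.fst‖ ≤ ‖u‖` and from the energy bound `m + 1`, which controls the gradient.
  let S : ℕ → Set (L2Pair M) := fun n => {w | w ∈ K ∧ pairEnergy h w ≤ m + 1 / ((n : ℝ) + 1)}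
  obtain ⟨w, hw⟩ := exists_forall_mem_of_antitone_convex (S := S)
    (fun n k hnk w hw => ⟨hw.1, hw.2.trans (by
      have : (n : ℝ) ≤ k := by exact_mod_cast hnk
      gcongr)⟩)
    (fun n => by
      obtain ⟨_, ⟨w, hw, rfl⟩, hlt⟩ := exists_lt_of_csInf_lt (s := pairEnergy h '' K)
        ⟨_, 0, hK0, rfl⟩ (b := m + 1 / ((n : ℝ) + 1)) (by
          have : 0 < 1 / ((n : ℝ) + 1) := by positivity
          linarith)
      exact ⟨w, hw, hlt.le⟩)
    (fun n => hKcl.inter (isClosed_le (continuous_pairEnergy h) continuous_const))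
    (fun n => hKcv.inter (t := {w | pairEnergy h w ≤ m + 1 / ((n : ℝ) + 1)}) (by
      simpa only [Set.mem_univ, true_and] using
        (convexOn_pairEnergy h).convex_le (m + 1 / ((n : ℝ) + 1))))
    (R := √(‖u‖ ^ 2 + (m + 1 + 2 * (‖h‖ * ‖u‖)))) (by
      rintro w ⟨hwK, hwE⟩
      refine Real.le_sqrt_of_sq_le ?_
      rw [WithLp.prod_norm_sq_eq_of_L2]
      have h1 : ‖w.fst‖ ^ 2 ≤ ‖u‖ ^ 2 := by
        have := hfst w hwK
        gcongr
      have h2 := hin w hwK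
      rw [pairEnergy] at hwE
      norm_num at hwE
      linarith)
  refine ⟨w, hKsub (hw 0).1, fun z hz => ?_⟩
  obtain ⟨z', hz', hzz⟩ := hKred z hz
  rw [← hzz]
  have h1 : pairEnergy h w ≤ m := by
    have h2 : Tendsto (fun n : ℕ => m + 1 / ((n : ℝ) + 1)) atTop (𝓝 (m + 0)) :=
      tendsto_const_nhds.add tendsto_one_div_add_atTop_nhds_zero_nat
    rw [add_zero] at h2
    exact ge_of_tendsto' h2 fun n => (hw n).2
  exact h1.trans (csInf_le hbdd ⟨z', hz', rfl⟩)

end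
end SurfaceObstacle
end

/-! ### Duality between vorticity mass and oscillation. -/

noncomputable section

namespace SurfaceObstacle

theorem sub_le_signedIntegral {X : Type*} [MeasurableSpace X] {μ : SignedMeasure X} {f : X → ℝ}
    (hf : ∀ ν : Measure X, IsFiniteMeasure ν → Integrable f ν) {c d : ℝ}
    (hcd : ∀ x, c ≤ f x ∧ f x ≤ d) :
    c * μ.toJordanDecomposition.posPart.real Set.univ
      - d * μ.toJordanDecomposition.negPart.real Set.univ ≤ signedIntegral μ f := by
  have h1 : c * μ.toJordanDecomposition.posPart.real Set.univ
      ≤ ∫ x, f x ∂μ.toJordanDecomposition.posPart := by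
    have := integral_mono (integrable_const c) (hf μ.toJordanDecomposition.posPart inferInstance)
      fun x => (hcd x).1
    rwa [integral_const, smul_eq_mul, mul_comm] at this
  have h2 : ∫ x, f x ∂μ.toJordanDecomposition.negPart
      ≤ d * μ.toJordanDecomposition.negPart.real Set.univ := by
    have := integral_mono (hf μ.toJordanDecomposition.negPart inferInstance) (integrable_const d)
      fun x => (hcd x).2
    rwa [integral_const, smul_eq_mul, mul_comm] at this
  rw [signedIntegral]
  linarith

theorem signedIntegral_one {X : Type*} [MeasurableSpace X] (μ : SignedMeasure X) :
    signedIntegral μ (fun _ => 1) = μ.toJordanDecomposition.posPart.real Set.univ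
      - μ.toJordanDecomposition.negPart.real Set.univ := by
  simp [signedIntegral]

theorem toReal_totalVariation_univ {X : Type*} [MeasurableSpace X] (μ : SignedMeasure X) :
    (μ.totalVariation Set.univ).toReal = μ.toJordanDecomposition.posPart.real Set.univ
      + μ.toJordanDecomposition.negPart.real Set.univ := by
  rw [SignedMeasure.totalVariation, ← measureReal_def, measureReal_add_apply]

section

variable {M : Set R3} (hM : IsSmoothSurface M) (hMc : IsCompact M) {H : R3 → ℝ}
  {h : Lp ℝ 2 (area M)} {V : R3 → ℝ} {w : L2Pair M}

theorem obstacleEnergy_eq (hH : h =ᵐ[area M] H) (hw : w ∈ sobolev hM hMc)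
    (hV : w.fst =ᵐ[area M] V) : obstacleEnergy M H V = pairEnergy h w := by
  have h1 : obstacleEnergy M H V
      = ∫ x, (inner ℝ (w.snd x) (w.snd x) + 2 * inner ℝ (h x) (w.fst x)) ∂area M := by
    refine integral_congr_ae ?_
    filter_upwards [hH, hV, weakGrad_ae_eq hM hMc hw hV] with x h1 h2 h3
    rw [h1, h2, h3, real_inner_self_eq_norm_sq]
    simp only [RCLike.inner_apply, conj_trivial]
    ring
  rw [h1, integral_add (L2.integrable_inner _ _) ((L2.integrable_inner _ _).const_mul 2),
    integral_const_mul, ← L2.inner_def, ← L2.inner_def, real_inner_self_eq_norm_sq, pairEnergy]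

theorem lintegral_enorm_weakGrad_sq (hw : w ∈ sobolev hM hMc) (hV : w.fst =ᵐ[area M] V) :
    ∫⁻ x, ‖weakGrad M V x‖ₑ ^ 2 ∂area M = ENNReal.ofReal (‖w.snd‖ ^ 2) := by
  rw [← real_inner_self_eq_norm_sq, L2.inner_def,
    ofReal_integral_eq_lintegral_ofReal (L2.integrable_inner _ _)
      (Eventually.of_forall fun x => real_inner_self_nonneg)]
  refine lintegral_congr_ae ?_
  filter_upwards [weakGrad_ae_eq hM hMc hw hV] with x hx
  rw [hx, real_inner_self_eq_norm_sq, ENNReal.ofReal_pow (norm_nonneg _), ofReal_norm]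

theorem isVorticity_iff (hH : h =ᵐ[area M] H) (hw : w ∈ sobolev hM hMc)
    (hV : w.fst =ᵐ[area M] V) {μ : SignedMeasure M} :
    IsVorticity M H V μ ↔ ∀ φ : smoothFunctions,
      pairing h w (jet hM hMc φ) = signedIntegral μ fun x : M => (φ : R3 → ℝ) x := by
  have key : ∀ φ : smoothFunctions,
      ∫ x, inner ℝ (weakGrad M V x) (tangentialGrad M φ x) ∂area M
        + ∫ x, H x * (φ : R3 → ℝ) x ∂area M = pairing h w (jet hM hMc φ) := by
    intro φ
    rw [pairing, L2.inner_def, L2.inner_def]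
    congr 1
    · refine integral_congr_ae ?_
      filter_upwards [weakGrad_ae_eq hM hMc hw hV, jet_snd hM hMc φ] with x h1 h2
      rw [h1, h2]
    · refine integral_congr_ae ?_
      filter_upwards [hH, jet_fst hM hMc φ] with x h1 h2
      rw [h1, h2]
      simp only [RCLike.inner_apply, conj_trivial]
      ring
  exact ⟨fun hμ φ => (key φ).symm.trans (hμ φ φ.2),
    fun hμ φ hφ => (key ⟨φ, hφ⟩).trans (hμ ⟨φ, hφ⟩)⟩

theorem integrable_coe_smooth (hMc : IsCompact M) (φ : smoothFunctions) (ν : Measure M)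
    (_ : IsFiniteMeasure ν) : Integrable (fun x : M => (φ : R3 → ℝ) x) ν := by
  have : CompactSpace M := isCompact_iff_compactSpace.1 hMc
  exact (BoundedContinuousFunction.mkOfCompact
    ⟨fun x : M => (φ : R3 → ℝ) x, (contDiff_coe φ).continuous.comp continuous_subtype_val⟩).integrable ν

/-- The mass of the vorticity controls its pairing with the admissible class. -/
theorem neg_pairing_le_totalVariation (hH : h =ᵐ[area M] H) (hh : ∫ x, h x ∂area M = 0)
    (hw : w ∈ sobolev hM hMc) (hV : w.fst =ᵐ[area M] V) {μ : SignedMeasure M}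
    (hμ : IsVorticity M H V μ) {β : ℝ} (hβ : 0 < β) {z : L2Pair M}
    (hz : z ∈ admissiblePairs hM hMc β) :
    -(2 * pairing h w z) ≤ β * (μ.totalVariation Set.univ).toReal := by
  rw [isVorticity_iff hM hMc hH hw hV] at hμ
  obtain ⟨hz, a, ha⟩ := hz
  -- Test with the constant `1`: its gradient vanishes and `H` has mean zero, so the total charge is
  -- zero.
  have hbal : μ.toJordanDecomposition.posPart.real Set.univ
      = μ.toJordanDecomposition.negPart.real Set.univ := by
    have h1 := hμ ⟨fun _ => 1, (contDiff_const : ContDiff ℝ ∞ _)⟩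
    change pairing h w (constPair hM hMc 1) = _ at h1
    rw [pairing, constPair_snd, inner_constPair hM hMc hh, inner_zero_right, add_zero] at h1
    change 0 = signedIntegral μ fun _ => 1 at h1
    rw [signedIntegral_one] at h1
    linarith
  rw [toReal_totalVariation_univ, ← hbal]
  set p := μ.toJordanDecomposition.posPart.real Set.univ with hp
  -- `IsVorticity` only speaks of smooth functions, so `z` is approximated by smooth functions of
  -- oscillation at most `β + 2 * ε`. With equal masses `p`, the integral of each is at least `-(β +
  -- 2 * ε) * p`.
  have hε : ∀ ε : ℝ, 0 < ε → -((β + 2 * ε) * p) ≤ pairing h w z := by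
    intro ε hε
    obtain ⟨φ, hφ, hlim⟩ := exists_tendsto_jet_of_bounds hM hMc hz
      (show a < a + β by linarith) hε ha
    refine ge_of_tendsto' (((continuous_pairing h w).tendsto z).comp hlim) fun n => ?_
    rw [Function.comp_apply, hμ (φ n)]
    have h1 := sub_le_signedIntegral (μ := μ) (integrable_coe_smooth hMc (φ n))
      fun x => hφ n x
    rw [← hbal, ← hp] at h1
    linarith
  have hlim : Tendsto (fun ε : ℝ => -((β + 2 * ε) * p)) (𝓝[>] 0) (𝓝 (-((β + 2 * 0) * p))) :=
    (Continuous.tendsto (by fun_prop) 0).mono_left nhdsWithin_le_nhds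
  have h2 := le_of_tendsto hlim (eventually_nhdsWithin_of_forall hε)
  linarith

/-- Duality bound: the mean-field energy dominates minus the obstacle energy of every admissible
function. -/
theorem le_meanFieldEnergy (hH : h =ᵐ[area M] H) (hh : ∫ x, h x ∂area M = 0)
    (hw : w ∈ sobolev hM hMc) (hV : w.fst =ᵐ[area M] V) {β : ℝ} (hβ : 0 < β) {z : L2Pair M}
    (hz : z ∈ admissiblePairs hM hMc β) :
    ENNReal.ofReal (‖w.snd - z.snd‖ ^ 2 - pairEnergy h z) ≤ meanFieldEnergy M H β V := by
  have h1 : ‖w.snd - z.snd‖ ^ 2 - pairEnergy h z = ‖w.snd‖ ^ 2 + -(2 * pairing h w z) := by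
    rw [norm_sub_sq_real, pairEnergy, pairing]
    ring
  -- Dividing by `β` lets the bound pass to the infimum, including the case of an empty infimum
  -- where the mass is `∞`.
  have h2 : ENNReal.ofReal (-(2 * pairing h w z) / β) ≤ vorticityMass M H V := by
    refine le_iInf₂ fun μ hμ => ENNReal.ofReal_le_of_le_toReal ?_
    rw [div_le_iff₀' hβ]
    exact neg_pairing_le_totalVariation hM hMc hH hh hw hV hμ hβ hz
  rw [h1, meanFieldEnergy, lintegral_enorm_weakGrad_sq hM hMc hw hV]
  refine ENNReal.ofReal_add_le.trans (add_le_add le_rfl ?_)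
  calc ENNReal.ofReal (-(2 * pairing h w z))
      = ENNReal.ofReal β * ENNReal.ofReal (-(2 * pairing h w z) / β) := by
        rw [← ENNReal.ofReal_mul hβ.le, mul_div_cancel₀ _ hβ.ne']
    _ ≤ _ := by gcongr

/-- A solution of the obstacle problem has mean-field energy at most minus its obstacle energy. -/
theorem meanFieldEnergy_le_of_isMin (hMne : M.Nonempty) (hH : h =ᵐ[area M] H)
    (hw : w ∈ sobolev hM hMc) (hV : w.fst =ᵐ[area M] V) {β : ℝ} (hβ : 0 < β)
    (hwK : w ∈ admissiblePairs hM hMc β)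
    (hmin : ∀ z ∈ admissiblePairs hM hMc β, pairEnergy h w ≤ pairEnergy h z) :
    meanFieldEnergy M H β V ≤ ENNReal.ofReal (-pairEnergy h w) := by
  have : CompactSpace M := isCompact_iff_compactSpace.1 hMc
  have : Nonempty M := hMne.to_subtype
  have hvar : ∀ z ∈ admissiblePairs hM hMc β, pairing h w w ≤ pairing h w z := fun z hz =>
    pairing_self_le_of_isMin h (convex_admissiblePairs hM hMc β) hwK hz hmin
  have hself : pairing h w w ≤ 0 := by
    have := hvar 0 (zero_mem_admissiblePairs hM hMc hβ.le)
    simpa [pairing] using this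
  -- The value for which `‖w.snd‖ ^ 2 + β * (2 * k)` equals minus the obstacle energy of `w`.
  set k := -pairing h w w / β with hk
  have hk0 : 0 ≤ k := div_nonneg (by linarith) hβ.le
  let r : smoothFunctions →ₗ[ℝ] C(M, ℝ) :=
    { toFun := fun φ =>
        ⟨fun x : M => (φ : R3 → ℝ) x, (contDiff_coe φ).continuous.comp continuous_subtype_val⟩
      map_add' := fun φ ψ => rfl
      map_smul' := fun c φ => rfl }
  let L : smoothFunctions →ₗ[ℝ] ℝ :=
    { toFun := fun φ => pairing h w (jet hM hMc φ)
      map_add' := fun φ ψ => by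
        simp only [pairing, map_add, WithLp.add_fst, WithLp.add_snd, inner_add_right]; ring
      map_smul' := fun c φ => by
        rw [map_smul, pairing_smul_right]; rfl }
  have hL : ∀ φ a b, (∀ x, a ≤ r φ x ∧ r φ x ≤ b) → L φ ≤ k * (b - a) := by
    intro φ a b hab
    have hab' : a ≤ b := (hab (Classical.arbitrary M)).1.trans (hab (Classical.arbitrary M)).2
    -- A strict bound `s` avoids dividing by zero when `a = b`. The function `-(β / s) φ` has
    -- oscillation at most `β`, so it is an admissible competitor; afterwards `s` decreases to `b -
    -- a`.
    have hs : ∀ s : ℝ, b - a < s → L φ ≤ k * s := by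
      intro s hs
      have hs0 : 0 < s := by linarith
      have h1 : (-(β / s)) • jet hM hMc φ ∈ admissiblePairs hM hMc β := by
        refine ⟨Submodule.smul_mem _ _ (jet_mem_sobolev hM hMc φ), -(β / s) * b, ?_⟩
        rw [WithLp.smul_fst]
        filter_upwards [jet_fst hM hMc φ, Lp.coeFn_smul (-(β / s)) (jet hM hMc φ).fst,
          ae_mem_area hMc] with x h1 h2 hx
        rw [h2, Pi.smul_apply, h1, smul_eq_mul]
        have h3 : a ≤ (φ : R3 → ℝ) x ∧ (φ : R3 → ℝ) x ≤ b := hab ⟨x, hx⟩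
        have h4 : 0 < β / s := by positivity
        have h5 : β = β / s * s := by field_simp
        constructor
        · nlinarith [mul_le_mul_of_nonneg_left h3.2 h4.le]
        · nlinarith [mul_le_mul_of_nonneg_left (show b - (φ : R3 → ℝ) x ≤ s by linarith) h4.le]
      have h2 := hvar _ h1
      rw [pairing_smul_right] at h2
      change pairing h w (jet hM hMc φ) ≤ k * s
      have h3 : β / s * pairing h w (jet hM hMc φ) ≤ -pairing h w w := by linarith
      rw [hk, div_mul_eq_mul_div, le_div_iff₀ hβ]
      rw [div_mul_eq_mul_div, div_le_iff₀ hs0] at h3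
      linarith
    have hlim : Tendsto (fun s : ℝ => k * s) (𝓝[>] (b - a)) (𝓝 (k * (b - a))) :=
      (Continuous.tendsto (by fun_prop) _).mono_left nhdsWithin_le_nhds
    exact ge_of_tendsto hlim (eventually_nhdsWithin_of_forall hs)
  obtain ⟨μ, hμ, hμL⟩ := exists_signedMeasure_of_le_osc r L hk0 hL
  have hμv : IsVorticity M H V μ :=
    (isVorticity_iff hM hMc hH hw hV).2 fun φ => (hμL φ).symm
  have hmass : vorticityMass M H V ≤ ENNReal.ofReal (2 * k) := (iInf₂_le μ hμv).trans hμ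
  rw [meanFieldEnergy, lintegral_enorm_weakGrad_sq hM hMc hw hV]
  calc ENNReal.ofReal (‖w.snd‖ ^ 2) + ENNReal.ofReal β * vorticityMass M H V
      ≤ ENNReal.ofReal (‖w.snd‖ ^ 2) + ENNReal.ofReal β * ENNReal.ofReal (2 * k) := by gcongr
    _ = ENNReal.ofReal (‖w.snd‖ ^ 2 + β * (2 * k)) := by
        rw [← ENNReal.ofReal_mul hβ.le, ← ENNReal.ofReal_add (by positivity) (by positivity)]
    _ = ENNReal.ofReal (-pairEnergy h w) := by
        congr 1
        rw [hk, mul_left_comm, mul_div_cancel₀ _ hβ.ne', pairing_self, pairEnergy]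
        ring

/-- A function whose pair is admissible is admissible, and conversely. -/
theorem mem_admissible_iff (hne : (ae (area M)).NeBot) (hw : w ∈ sobolev hM hMc)
    (hV : w.fst =ᵐ[area M] V) (hV1 : MemH1 M V) {β : ℝ} :
    V ∈ admissible M β ↔ w ∈ admissiblePairs hM hMc β := by
  have h1 : V ∈ admissible M β ↔ MemH1 M V ∧ essOsc M V ≤ (β : EReal) := Iff.rfl
  rw [h1, essOsc_le_iff hne]
  refine ⟨fun h => ⟨hw, ?_⟩, fun h => ⟨hV1, ?_⟩⟩
  · obtain ⟨-, a, ha⟩ := h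
    refine ⟨a, ?_⟩
    filter_upwards [ha, hV] with x h2 h3
    rwa [h3]
  · obtain ⟨-, a, ha⟩ := h
    refine ⟨a, ?_⟩
    filter_upwards [ha, hV] with x h2 h3
    rwa [← h3]

end
end SurfaceObstacle
end

/-! ### The equivalence of the two minimum problems. -/

open SurfaceObstacle

theorem proposition2p1 (M : Set SurfaceObstacle.R3) (hM : IsCompact M)
    (hMsmooth : SurfaceObstacle.IsSmoothSurface M)
    (hMsphere : Nonempty (M ≃ₜ Metric.sphere (0 : SurfaceObstacle.R3) 1))
    (H : SurfaceObstacle.R3 → ℝ) (hH : ContDiffOn ℝ 1 H M)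
    (hHmean : ∫ x, H x ∂SurfaceObstacle.area M = 0)
    (β : ℝ) (hβ : 0 < β)
    (V₀ : SurfaceObstacle.R3 → ℝ) (hV₀ : SurfaceObstacle.MemH1 M V₀) :
    (∀ V : SurfaceObstacle.R3 → ℝ, SurfaceObstacle.MemH1 M V →
        SurfaceObstacle.meanFieldEnergy M H β V₀ ≤ SurfaceObstacle.meanFieldEnergy M H β V) ↔
      (V₀ ∈ SurfaceObstacle.admissible M β ∧
        ∀ V ∈ SurfaceObstacle.admissible M β,
          SurfaceObstacle.obstacleEnergy M H V₀ ≤ SurfaceObstacle.obstacleEnergy M H V) := by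
  have hconn : IsConnected M := by
    have h1 : IsConnected (Metric.sphere (0 : R3) 1) :=
      isConnected_sphere (by simp [← Module.finrank_eq_rank]) 0 zero_le_one
    have h2 : ConnectedSpace (Metric.sphere (0 : R3) 1) := isConnected_iff_connectedSpace.1 h1
    exact isConnected_iff_connectedSpace.2
      (hMsphere.some.symm.surjective.connectedSpace hMsphere.some.symm.continuous)
  obtain ⟨p, hp⟩ := hconn.nonempty
  have hne : (ae (area M)).NeBot := by
    rw [ae_neBot]
    intro h0
    exact hMsmooth.area_ne_zero_of_mem_nhdsWithin hp univ_mem (by rw [h0]; rfl)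
  have hHL : MemLp H 2 (area M) := memLp_area_of_continuousOn hMsmooth hM hH.continuousOn
  set h := hHL.toLp H with hh
  have hhH : h =ᵐ[area M] H := hHL.coeFn_toLp
  have hmean : ∫ x, h x ∂area M = 0 := by rw [integral_congr_ae hhH, hHmean]
  obtain ⟨G₀, hG₀⟩ := hV₀
  obtain ⟨w, hw, hwV, -⟩ := hG₀.exists_mem_sobolev hMsmooth hM
  have hV₀ : MemH1 M V₀ := ⟨G₀, hG₀⟩
  have hadm := mem_admissible_iff hMsmooth hM hne hw hwV hV₀ (β := β)
  have hrep : ∀ V, MemH1 M V → ∃ z ∈ sobolev hMsmooth hM, z.fst =ᵐ[area M] V := by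
    rintro V ⟨G, hG⟩
    obtain ⟨z, hz, hzV, -⟩ := hG.exists_mem_sobolev hMsmooth hM
    exact ⟨z, hz, hzV⟩
  constructor
  · intro hmin
    obtain ⟨w₁, hw₁, hmin₁⟩ := exists_isMin_pairEnergy hMsmooth hM hmean hβ.le
    have hE₁ := meanFieldEnergy_le_of_isMin hMsmooth hM hconn.nonempty hhH hw₁.1
      (EventuallyEq.refl _ _) hβ hw₁ hmin₁
    have hE₂ := le_meanFieldEnergy hMsmooth hM hhH hmean hw hwV hβ hw₁
    -- Comparison with `0`; it makes `-pairEnergy h w₁` nonnegative, so that `ENNReal.ofReal` does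
    -- not truncate it.
    have hF₁ : pairEnergy h w₁ ≤ 0 := by
      have := hmin₁ 0 (zero_mem_admissiblePairs hMsmooth hM hβ.le)
      simpa [pairEnergy] using this
    -- The energy of `V₀` is at least `‖∇w - ∇w₁‖ ^ 2` minus the obstacle energy of `w₁`, and at
    -- most minus that energy, so the gradients coincide.
    have h1 := (hE₂.trans (hmin _ (memH1_of_mem_sobolev hMsmooth hM hw₁.1))).trans hE₁
    rw [ENNReal.ofReal_le_ofReal_iff (by linarith)] at h1
    have h2 : w.snd - w₁.snd = 0 := by
      rw [← norm_eq_zero]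
      nlinarith [norm_nonneg (w.snd - w₁.snd)]
    -- Equal gradients on a connected surface leave only an additive constant, which preserves
    -- admissibility and obstacle energy.
    obtain ⟨k, hk⟩ := exists_ae_eq_const_of_mem_sobolev hMsmooth hM hconn
      (Submodule.sub_mem _ hw hw₁.1) (by rw [WithLp.sub_snd, h2])
    have h3 : w = w₁ + constPair hMsmooth hM k := by
      have h4 : w.fst = w₁.fst + (constPair hMsmooth hM k).fst := by
        rw [← sub_eq_iff_eq_add']
        refine Lp.ext ?_
        filter_upwards [hk, constPair_fst hMsmooth hM k] with x h5 h6
        rw [h6, ← h5, WithLp.sub_fst]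
      have h5 : w.snd = w₁.snd + (constPair hMsmooth hM k).snd := by
        rw [constPair_snd, add_zero, ← sub_eq_zero, h2]
      exact WithLp.ofLp_injective 2 (Prod.ext h4 h5)
    have hwK : w ∈ admissiblePairs hMsmooth hM β := by
      rw [h3]; exact add_constPair_mem_admissiblePairs hMsmooth hM hw₁ k
    refine ⟨hadm.2 hwK, fun V hV => ?_⟩
    obtain ⟨z, hz, hzV⟩ := hrep V hV.1
    rw [obstacleEnergy_eq hMsmooth hM hhH hw hwV, obstacleEnergy_eq hMsmooth hM hhH hz hzV, h3,
      pairEnergy_add_constPair hMsmooth hM hmean]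
    exact hmin₁ z ((mem_admissible_iff hMsmooth hM hne hz hzV hV.1).1 hV)
  · rintro ⟨hV₀K, hmin⟩ V hV
    have hwK := hadm.1 hV₀K
    have hminw : ∀ z ∈ admissiblePairs hMsmooth hM β, pairEnergy h w ≤ pairEnergy h z := by
      intro z hz
      have hz1 := memH1_of_mem_sobolev hMsmooth hM hz.1
      have h1 := hmin z.fst
        ((mem_admissible_iff hMsmooth hM hne hz.1 (EventuallyEq.refl _ _) hz1).2 hz)
      rwa [obstacleEnergy_eq hMsmooth hM hhH hw hwV,
        obstacleEnergy_eq hMsmooth hM hhH hz.1 (EventuallyEq.refl _ _)] at h1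
    obtain ⟨v, hv, hvV⟩ := hrep V hV
    calc meanFieldEnergy M H β V₀
        ≤ ENNReal.ofReal (-pairEnergy h w) :=
          meanFieldEnergy_le_of_isMin hMsmooth hM hconn.nonempty hhH hw hwV hβ hwK hminw
      _ ≤ ENNReal.ofReal (‖v.snd - w.snd‖ ^ 2 - pairEnergy h w) :=
          ENNReal.ofReal_le_ofReal (by nlinarith [sq_nonneg ‖v.snd - w.snd‖])
      _ ≤ meanFieldEnergy M H β V := le_meanFieldEnergy hMsmooth hM hhH hmean hv hvV hβ hwK
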